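/- Let $A\in\mathbb R^{n\times n}$ (possibly nonsymmetric) and let $Q\in\mathbb R^{n\times n}$ be symmetric positive semidefinite. For a real $n\times n$ matrix $M$ let $\mathrm{Off}(M)=\{M(s+1:n,1:s),\ M(1:s,s+1:n):\ s=1,\dots,n-1\}$ be the set of its maximal offdiagonal blocks; $M$ is quasiseparable of order $r$ if $r$ is the maximal rank of the matrices in $\mathrm{Off}(M)$. Suppose that $A$ and $Q$ are quasiseparable of orders $r_a$ and $r_q$, and that the numerical range $\mathcal W(A)=\{x^HAx:\ x\in\mathbb C^n,\ \|x\|_2=1\}$ is contained in the open left half plane $\{z\in\mathbb C:\ \Re(z)<0\}$. Let $X\in\mathbb R^{n\times n}$ be the symmetric positive semidefinite (stabilizing) solution of the Riccati equation $$A^\top X+XA-X^2+Q=0 .$$ Put $$t=4r_a+2r_q,\qquad \tau=\left|\min(\mathcal W(A)\cap\mathbb R)\right|,\qquad E=\mathcal W(A)+\left[-\tau-\sqrt{\tau^2+\|Q\|_2},\ 0\right],$$ and for sets $E,G\subset\mathbb C$ let $$Z_h(E,G)=\inf_{g\in\mathcal R_{h,h}}\frac{\sup_{z\in E}|g(z)|}{\inf_{z\in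 G}|g(z)|},$$ where $\mathcal R_{h,h}$ is the set of complex rational functions with numerator and denominator of degree at most $h$, restricted to those without poles in $E$ and without zeros in $G$. Then, for every $M\in\mathrm{Off}(X)$ and every $h=1,2,\dots$, the singular values $\sigma_1(M)\ge\sigma_2(M)\ge\cdots$ (with $\sigma_k(M)=0$ for $k$ larger than the size of $M$) satisfy $$\sigma_{ht+1}(M)\le(1+\sqrt2)^2\,Z_h(E,-E)\,\|X\|_2 ,$$ that is, $\sigma_{ht+1}(M)/\|X\|_2\le(1+\sqrt2)^2Z_h(E,-E)$ whenever $X\ne0$. -/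

import Mathlib

/- Set addition and negation are pointwise; the norm of a matrix is the spectral norm. -/
open scoped Pointwise Matrix.Norms.L2Operator

noncomputable section

/-- The numerical range `{xᴴ A x : x ∈ ℂⁿ, ‖x‖₂ = 1}` of a real square matrix `A`. -/
def numericalRange {n : ℕ} (A : Matrix (Fin n) (Fin n) ℝ) : Set ℂ :=
  {z | ∃ x : EuclideanSpace ℂ (Fin n), ‖x‖ = 1 ∧
    z = dotProduct (star (x : Fin n → ℂ)) ((A.map Complex.ofReal).mulVec (x : Fin n → ℂ))}

/-- The maximal strictly lower triangular block `M(s+1:n, 1:s)` (rows and columns are numbered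
from `0` here, so the rows are those with `s ≤ i` and the columns those with `j < s`). -/
def lowerOffBlock {n : ℕ} (M : Matrix (Fin n) (Fin n) ℝ) (s : ℕ) :
    Matrix {i : Fin n // s ≤ i.val} {j : Fin n // j.val < s} ℝ :=
  M.submatrix Subtype.val Subtype.val

/-- The maximal strictly upper triangular block `M(1:s, s+1:n)`. -/
def upperOffBlock {n : ℕ} (M : Matrix (Fin n) (Fin n) ℝ) (s : ℕ) :
    Matrix {i : Fin n // i.val < s} {j : Fin n // s ≤ j.val} ℝ :=
  M.submatrix Subtype.val Subtype.val

/-- The quasiseparable order: the maximal rank of the offdiagonal blocks with cut position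
`s = 1, …, n - 1` (it is `0` if `n ≤ 1`, when there are no such blocks). -/
def qsrank {n : ℕ} (M : Matrix (Fin n) (Fin n) ℝ) : ℕ :=
  (Finset.Ico 1 n).sup fun s => max (lowerOffBlock M s).rank (upperOffBlock M s).rank

/-- The `k`-th largest singular value `σ_k` of a real matrix, `k = 1, 2, …`, with multiplicity;
it is `0` if `k` exceeds the rank. -/
def singularValue {m n : Type*} [Fintype m] [Fintype n] [DecidableEq n]
    (M : Matrix m n ℝ) (k : ℕ) : ℝ :=
  (Matrix.toEuclideanLin M).singularValues (k - 1)

/-- `X` solves the continuous-time algebraic Riccati equation with coefficients `A, F, Q`. -/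
def SolvesRiccati {n : ℕ} (A F Q X : Matrix (Fin n) (Fin n) ℝ) : Prop :=
  A.transpose * X + X * A - X * F * X + Q = 0

/-- The modulus `|g(z)|` of a rational function, with value `∞` at a pole. (Numerator and
denominator are coprime, so the quotient is never `0 / 0`.) -/
def ratFuncModulus (g : RatFunc ℂ) (z : ℂ) : ENNReal :=
  ‖g.num.eval z‖ₑ / ‖g.denom.eval z‖ₑ

/-- Rational functions with numerator and denominator of degree at most `h`, without poles in `E`
and without zeros in `G`, i.e. those for which the Zolotarev quotient below is meaningful. -/
def zolotarevAdmissible (h : ℕ) (E G : Set ℂ) : Set (RatFunc ℂ) :=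
  {g | g.num.natDegree ≤ h ∧ g.denom.natDegree ≤ h ∧
    (∀ z ∈ E, g.denom.eval z ≠ 0) ∧ (∀ z ∈ G, g.num.eval z ≠ 0)}

/-- The Zolotarev number `Z_h(E, G)`: the optimal value of `sup_E |g| / inf_G |g|` over the
rational functions `g` with numerator and denominator of degree at most `h`. -/
def zolotarevNumber (h : ℕ) (E G : Set ℂ) : ENNReal :=
  ⨅ g ∈ zolotarevAdmissible h E G,
    (⨆ z ∈ E, ratFuncModulus g z) / (⨅ z ∈ G, ratFuncModulus g z)

/-- `τ = |min (W(A) ∩ ℝ)|`. If `n ≥ 1`, the set `W(A) ∩ ℝ` is compact and non-empty, so the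
infimum is a minimum. -/
def numericalRangeTau {n : ℕ} (A : Matrix (Fin n) (Fin n) ℝ) : ℝ :=
  |sInf {x : ℝ | (x : ℂ) ∈ numericalRange A}|

/-- The set `W(A) + [-τ - √(τ² + ‖Q‖₂), 0]`. -/
def decaySet {n : ℕ} (A Q : Matrix (Fin n) (Fin n) ℝ) : Set ℂ :=
  numericalRange A + (Complex.ofReal '' Set.Icc
    (-numericalRangeTau A - Real.sqrt (numericalRangeTau A ^ 2 + ‖Q‖)) 0)

end

/-! Fix a cut and let `M` be the corresponding offdiagonal block of `X`. Restricted to this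
position, the Riccati equation becomes a Sylvester equation: the quadratic term splits between the
two diagonal blocks `L = (Aᵀ - X)_PP` and `N = -(A - X)_RR`, and `L M - M N` has rank at most `2 ra
+ rq`. Testing the Riccati equation on eigenvectors of `X` gives `‖X‖² ≤ ‖Q‖`
(`SolvesRiccati.norm_le`), so the numerical ranges of `L` and `N` lie in `E` and `-E`.

If `L M - M N = F G`, then `M r(N) v = r(L) M v` for every polynomial `r` of degree at most `d` and
every `v` with `G N^j v = 0` for `j < d`. For `w = p(N) v`, comparing `p` with `q` at `L` and `q`
with `p` at `N` bounds `‖M w‖` on a subspace of codimension at most `d` times the width of the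
factorization (`singularValue_le_of_sylvester`). Each comparison costs the constant for which the
numerical range is a spectral set.

The stated constant leaves room. Since `t` is twice the rank, `g²` may be used in place of `g`. With
spectral constant 3 and Zolotarev quotient `u` this gives `σ ≤ 9 u² ‖M‖`; combined with `σ ≤ ‖M‖` it
gives `σ ≤ 3 u ‖M‖`, and `3 ≤ (1 + √2)²`.

The constant 3 comes from a simplified Crouzeix-Palencia argument
(`IsSpectralResolution.norm_le_three`). If `|f| ≤ 1` near a convex set containing the numerical
range of `B`, and `g` is the Cauchy transform of the conjugate of `f`, then `‖f(B) + g(B)ᴴ‖ ≤ 2`,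
because the double layer potential of a convex contour is a positive operator density of mass 2. An
elementary bound gives `|g| ≤ 3`. Feeding `f g f / 3` back into the supremum `K` of all `‖f(B)‖`
yields `K² ≤ 2 K + 3`, so `K ≤ 3`. This is done for simple spectrum, where the functional calculus
is a finite sum, and extended by perturbation in `norm_aeval_apply_le`. -/

noncomputable section

/-! ### Support functions and a smooth contour around a compact convex set. -/

/-- The component `Re (e^{-it} z)` of `z` in the direction `e^{it}`. -/
def dirRe (t : ℝ) : ℂ →L[ℝ] ℝ := Real.cos t • Complex.reCLM + Real.sin t • Complex.imCLM

theorem dirRe_apply (t : ℝ) (z : ℂ) : dirRe t z = Real.cos t * z.re + Real.sin t * z.im := by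
  simp [dirRe]

theorem dirRe_eq_re (t : ℝ) (z : ℂ) : dirRe t z = (Complex.exp (-(t * Complex.I)) * z).re := by
  rw [dirRe_apply, ← neg_mul, Complex.exp_mul_I]
  simp [← Complex.ofReal_cos, ← Complex.ofReal_sin, -Complex.ofReal_neg]

theorem dirRe_le_norm (t : ℝ) (z : ℂ) : dirRe t z ≤ ‖z‖ := by
  rw [dirRe_eq_re]
  refine (Complex.re_le_norm _).trans ?_
  rw [norm_mul, ← neg_mul, ← Complex.ofReal_neg, Complex.norm_exp_ofReal_mul_I, one_mul]

theorem dirRe_sub_le (s t : ℝ) (z : ℂ) : dirRe t z - dirRe s z ≤ ‖z‖ * |t - s| := by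
  rw [dirRe_eq_re, dirRe_eq_re, ← Complex.sub_re, ← sub_mul]
  refine (Complex.re_le_norm _).trans ?_
  rw [norm_mul, mul_comm]
  gcongr
  have : Complex.exp (-(t * Complex.I)) - Complex.exp (-(s * Complex.I)) =
      Complex.exp (((-s : ℝ) : ℂ) * Complex.I) *
        (Complex.exp (Complex.I * ((s - t : ℝ) : ℂ)) - 1) := by
    rw [mul_sub, mul_one, ← Complex.exp_add]
    push_cast
    ring_nf
  rw [this, norm_mul, Complex.norm_exp_ofReal_mul_I, one_mul, abs_sub_comm]
  exact Real.norm_exp_I_mul_ofReal_sub_one_le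

/-- `h` is the support function of `C` in polar coordinates. -/
structure IsSupportFun (C : Set ℂ) (h : ℝ → ℝ) : Prop where
  le : ∀ z ∈ C, ∀ t, dirRe t z ≤ h t
  attained : ∀ t, ∃ a ∈ C, h t = dirRe t a

theorem IsCompact.exists_isSupportFun {C : Set ℂ} (hC : IsCompact C) (hne : C.Nonempty) :
    ∃ h, IsSupportFun C h := by
  have : ∀ t, ∃ a ∈ C, ∀ z ∈ C, dirRe t z ≤ dirRe t a := fun t =>
    hC.exists_isMaxOn hne (dirRe t).continuous.continuousOn
  choose a ha hmax using this
  exact ⟨fun t => dirRe t (a t), fun z hz t => hmax t z hz, fun t => ⟨a t, ha t, rfl⟩⟩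

namespace IsSupportFun

variable {C : Set ℂ} {h : ℝ → ℝ} {R : ℝ}

theorem add_two_pi (H : IsSupportFun C h) (t : ℝ) : h (t + 2 * Real.pi) = h t := by
  have key : ∀ z, dirRe (t + 2 * Real.pi) z = dirRe t z := by simp [dirRe_apply]
  obtain ⟨a, ha, hat⟩ := H.attained t
  obtain ⟨b, hb, hbt⟩ := H.attained (t + 2 * Real.pi)
  apply le_antisymm
  · rw [hbt, key]; exact H.le b hb t
  · rw [hat, ← key]; exact H.le a ha _

theorem sub_le (H : IsSupportFun C h) (hR : ∀ z ∈ C, ‖z‖ ≤ R) (s t : ℝ) :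
    h t - h s ≤ R * |t - s| := by
  obtain ⟨a, ha, hat⟩ := H.attained t
  have h1 := H.le a ha s
  have h2 := dirRe_sub_le s t a
  have h3 : ‖a‖ * |t - s| ≤ R * |t - s| := by gcongr; exact hR a ha
  linarith

theorem abs_le (H : IsSupportFun C h) (hR : ∀ z ∈ C, ‖z‖ ≤ R) (t : ℝ) : |h t| ≤ R := by
  obtain ⟨a, ha, hat⟩ := H.attained t
  rw [hat, ← Real.norm_eq_abs, dirRe_eq_re]
  refine le_trans (Complex.abs_re_le_norm _) ?_
  rw [norm_mul, ← neg_mul, ← Complex.ofReal_neg, Complex.norm_exp_ofReal_mul_I, one_mul]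
  exact hR a ha

theorem continuous (H : IsSupportFun C h) (hR : ∀ z ∈ C, ‖z‖ ≤ R) : Continuous h := by
  have : LipschitzWith R.toNNReal h := LipschitzWith.of_le_add_mul' R fun t s => by
    have := H.sub_le hR s t
    rw [Real.dist_eq]
    linarith
  exact this.continuous

/-- A discrete form of `h'' + h ≥ 0`, which needs no smoothness of `h`: test the directions `t ± u`
on the point of contact in direction `t`. It makes the density of the smoothed contour nonnegative.
-/
theorem two_mul_cos_mul_le (H : IsSupportFun C h) (t u : ℝ) :
    2 * Real.cos u * h t ≤ h (t + u) + h (t - u) := by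
  obtain ⟨a, ha, hat⟩ := H.attained t
  have h1 := H.le a ha (t + u)
  have h2 := H.le a ha (t - u)
  rw [hat]
  rw [dirRe_apply] at h1 h2 ⊢
  rw [Real.cos_add, Real.sin_add] at h1
  rw [Real.cos_sub, Real.sin_sub] at h2
  linarith

end IsSupportFun

open Complex in
/-- A boundary curve of the average of rotated copies of the set with support function `h`. -/
def smoothedBoundary (h : ℝ → ℝ) (Δ t : ℝ) : ℂ :=
  ∫ u in (0 : ℝ)..Δ, (I / ((Δ * Real.sin Δ : ℝ) : ℂ)) *
    (h (t + u) * exp (((t + u - Δ : ℝ) : ℂ) * I) - h (t - u) * exp (((t - u + Δ : ℝ) : ℂ) * I))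

theorem smoothedBoundary_add_two_pi {h : ℝ → ℝ} (hper : ∀ t, h (t + 2 * Real.pi) = h t)
    (Δ t : ℝ) : smoothedBoundary h Δ (t + 2 * Real.pi) = smoothedBoundary h Δ t := by
  unfold smoothedBoundary
  congr 1
  ext u
  have e1 : ∀ s : ℝ, Complex.exp (((s + 2 * Real.pi : ℝ) : ℂ) * Complex.I) =
      Complex.exp ((s : ℂ) * Complex.I) := fun s => by
    rw [Complex.ofReal_add, add_mul]
    push_cast
    exact Complex.exp_periodic _
  rw [show t + 2 * Real.pi + u = (t + u) + 2 * Real.pi by ring,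
    show t + 2 * Real.pi - u = (t - u) + 2 * Real.pi by ring, hper, hper,
    show t + u + 2 * Real.pi - Δ = (t + u - Δ) + 2 * Real.pi by ring,
    show t - u + 2 * Real.pi + Δ = (t - u + Δ) + 2 * Real.pi by ring, e1, e1]

theorem hasDerivAt_integral_add {F : ℝ → ℂ} (hF : Continuous F) (Δ t : ℝ) :
    HasDerivAt (fun t => ∫ u in (0 : ℝ)..Δ, F (t + u)) (F (t + Δ) - F t) t := by
  have hG : ∀ x, HasDerivAt (fun x => ∫ u in (0 : ℝ)..x, F u) (F x) x := fun x =>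
    (hF.integral_hasStrictDerivAt 0 x).hasDerivAt
  have e : (fun t => ∫ u in (0 : ℝ)..Δ, F (t + u)) =
      fun t => (∫ u in (0 : ℝ)..(t + Δ), F u) - ∫ u in (0 : ℝ)..t, F u := by
    ext t
    rw [intervalIntegral.integral_comp_add_left, add_zero,
      intervalIntegral.integral_interval_sub_left (hF.intervalIntegrable _ _)
        (hF.intervalIntegrable _ _)]
  rw [e]
  exact ((hG (t + Δ)).comp_add_const t Δ).sub (hG t)

theorem hasDerivAt_integral_sub {F : ℝ → ℂ} (hF : Continuous F) (Δ t : ℝ) :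
    HasDerivAt (fun t => ∫ u in (0 : ℝ)..Δ, F (t - u)) (F t - F (t - Δ)) t := by
  have hG : ∀ x, HasDerivAt (fun x => ∫ u in (0 : ℝ)..x, F u) (F x) x := fun x =>
    (hF.integral_hasStrictDerivAt 0 x).hasDerivAt
  have e : (fun t => ∫ u in (0 : ℝ)..Δ, F (t - u)) =
      fun t => (∫ u in (0 : ℝ)..t, F u) - ∫ u in (0 : ℝ)..(t - Δ), F u := by
    ext t
    rw [intervalIntegral.integral_comp_sub_left, sub_zero,
      intervalIntegral.integral_interval_sub_left (hF.intervalIntegrable _ _)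
        (hF.intervalIntegrable _ _)]
  rw [e]
  exact (hG t).sub ((hG (t - Δ)).comp_sub_const t Δ)

-- The phases shifted by `∓Δ` in the integrand are chosen so that the endpoint terms of the two
-- moving integrals combine into one multiple of `exp (t * I)`. The tangent thus has the direction
-- belonging to the outer normal `exp (t * I)`, and its length is the second difference of
-- `two_mul_cos_mul_le`.
open Complex in
theorem hasDerivAt_smoothedBoundary {h : ℝ → ℝ} (hh : Continuous h) (Δ t : ℝ) :
    HasDerivAt (smoothedBoundary h Δ) (I * exp (t * I) *
      (((h (t + Δ) + h (t - Δ) - 2 * Real.cos Δ * h t) / (Δ * Real.sin Δ) : ℝ) : ℂ)) t := by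
  have h1 : Continuous fun x : ℝ => (h x : ℂ) * exp (((x - Δ : ℝ) : ℂ) * I) := by fun_prop
  have h2 : Continuous fun x : ℝ => (h x : ℂ) * exp (((x + Δ : ℝ) : ℂ) * I) := by fun_prop
  have e : smoothedBoundary h Δ = fun t => (I / ((Δ * Real.sin Δ : ℝ) : ℂ)) *
      ((∫ u in (0 : ℝ)..Δ, (fun x : ℝ => (h x : ℂ) * exp (((x - Δ : ℝ) : ℂ) * I)) (t + u)) -
      ∫ u in (0 : ℝ)..Δ, (fun x : ℝ => (h x : ℂ) * exp (((x + Δ : ℝ) : ℂ) * I)) (t - u)) := by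
    ext t
    rw [smoothedBoundary, intervalIntegral.integral_const_mul, intervalIntegral.integral_sub]
    · exact (h1.comp (continuous_const_add t)).intervalIntegrable _ _
    · exact (h2.comp (continuous_sub_left t)).intervalIntegrable _ _
  rw [e]
  refine (((hasDerivAt_integral_add h1 Δ t).sub
    (hasDerivAt_integral_sub h2 Δ t)).const_mul (I / ((Δ * Real.sin Δ : ℝ) : ℂ))).congr_deriv ?_
  have e1 : exp (((t - Δ : ℝ) : ℂ) * I) = exp (t * I) * exp (-Δ * I) := by
    rw [← exp_add]; push_cast; ring_nf
  have e2 : exp (((t + Δ : ℝ) : ℂ) * I) = exp (t * I) * exp (Δ * I) := by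
    rw [← exp_add]; push_cast; ring_nf
  simp only [add_sub_cancel_right, sub_add_cancel]
  rw [e1, e2]
  push_cast
  rw [Complex.two_cos]
  ring

theorem dirRe_smoothedBoundary {h : ℝ → ℝ} (hh : Continuous h) (Δ t : ℝ) :
    dirRe t (smoothedBoundary h Δ t) =
      (∫ u in (0 : ℝ)..Δ, Real.sin (Δ - u) * (h (t + u) + h (t - u))) / (Δ * Real.sin Δ) := by
  rw [smoothedBoundary, ← ContinuousLinearMap.intervalIntegral_comp_comm,
    ← intervalIntegral.integral_div]
  · congr 1
    ext u
    rw [div_eq_mul_inv Complex.I, ← Complex.ofReal_inv, mul_comm Complex.I, mul_assoc,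
      ← smul_eq_mul, Complex.coe_smul, map_smul, smul_eq_mul, dirRe_apply]
    have e1 : Real.sin (Δ - u) = Real.sin t * Real.cos (t + u - Δ) -
        Real.cos t * Real.sin (t + u - Δ) := by
      rw [← Real.sin_sub]; ring_nf
    have e2 : Real.sin (Δ - u) = Real.cos t * Real.sin (t - u + Δ) -
        Real.sin t * Real.cos (t - u + Δ) := by
      rw [mul_comm, mul_comm (Real.sin t), ← Real.sin_sub]; ring_nf
    have e3 : Real.sin (Δ - u) * (h (t + u) + h (t - u)) =
        (Real.sin t * Real.cos (t + u - Δ) - Real.cos t * Real.sin (t + u - Δ)) * h (t + u) +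
        (Real.cos t * Real.sin (t - u + Δ) - Real.sin t * Real.cos (t - u + Δ)) * h (t - u) := by
      rw [← e1, ← e2]; ring
    rw [e3]
    generalize t + u - Δ = x
    generalize t - u + Δ = y
    simp [Complex.exp_ofReal_mul_I_re, Complex.exp_ofReal_mul_I_im]
    ring
  · apply Continuous.intervalIntegrable
    fun_prop

/-- The normalization of the average: for a single point, `h (t + u) + h (t - u) = 2 cos u * h t`,
so points are reproduced exactly. -/
theorem integral_sin_sub_mul_cos (Δ : ℝ) :
    ∫ u in (0 : ℝ)..Δ, Real.sin (Δ - u) * (2 * Real.cos u) = Δ * Real.sin Δ := by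
  have : ∀ u ∈ Set.uIcc 0 Δ, HasDerivAt (fun u => u * Real.sin Δ + Real.cos (Δ - 2 * u) / 2)
      (Real.sin (Δ - u) * (2 * Real.cos u)) u := by
    intro u _
    have h1 : HasDerivAt (fun u => Real.cos (Δ - 2 * u)) (-Real.sin (Δ - 2 * u) * (-(2 * 1))) u :=
      (((hasDerivAt_id u).const_mul 2).const_sub Δ).cos
    refine (((hasDerivAt_id u).mul_const (Real.sin Δ)).add (h1.div_const 2)).congr_deriv ?_
    have e1 : Real.sin Δ = Real.sin (Δ - u) * Real.cos u + Real.cos (Δ - u) * Real.sin u := by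
      rw [← Real.sin_add]; ring_nf
    have e2 : Real.sin (Δ - 2 * u) =
        Real.sin (Δ - u) * Real.cos u - Real.cos (Δ - u) * Real.sin u := by
      rw [← Real.sin_sub]; ring_nf
    rw [e1, e2]; ring
  rw [intervalIntegral.integral_eq_sub_of_hasDerivAt this]
  · have : Real.cos (Δ - 2 * Δ) = Real.cos Δ := by
      rw [← Real.cos_neg]; ring_nf
    simp [this]
  · apply Continuous.intervalIntegrable
    fun_prop

section

variable {C : Set ℂ} {h : ℝ → ℝ} {R Δ : ℝ}

/-- The weight `sin (Δ - u)` is nonnegative, so the average is monotone in `h`; and it reproduces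
the support function of the single point `z`. -/
theorem IsSupportFun.le_dirRe_smoothedBoundary (H : IsSupportFun C h)
    (hR : ∀ z ∈ C, ‖z‖ ≤ R) (hΔ : 0 < Δ) (hΔ1 : Δ ≤ 1) {z : ℂ} (hz : z ∈ C) (t : ℝ) :
    dirRe t z ≤ dirRe t (smoothedBoundary h Δ t) := by
  have hcont := H.continuous hR
  have hs : 0 < Real.sin Δ := Real.sin_pos_of_pos_of_lt_pi hΔ (by linarith [Real.pi_gt_three])
  rw [dirRe_smoothedBoundary hcont, le_div_iff₀ (by positivity), ← integral_sin_sub_mul_cos,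
    ← intervalIntegral.integral_const_mul]
  apply intervalIntegral.integral_mono_on hΔ.le
  · apply Continuous.intervalIntegrable; fun_prop
  · apply Continuous.intervalIntegrable; fun_prop
  · intro u hu
    have h1 : 0 ≤ Real.sin (Δ - u) :=
      Real.sin_nonneg_of_nonneg_of_le_pi (by linarith [hu.2])
        (by linarith [hu.1, Real.pi_gt_three])
    have h2 : dirRe (t + u) z + dirRe (t - u) z = 2 * Real.cos u * dirRe t z := by
      simp only [dirRe_apply, Real.cos_add, Real.sin_add, Real.cos_sub, Real.sin_sub]; ring
    have h3 := H.le z hz (t + u)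
    have h4 := H.le z hz (t - u)
    calc _ = Real.sin (Δ - u) * (dirRe (t + u) z + dirRe (t - u) z) := by rw [h2]; ring
      _ ≤ _ := by gcongr

/-- Since `h` is `R`-Lipschitz and bounded by `R`, the difference `h (t + u) + h (t - u) - 2 cos u *
h t` is at most `2 R u + 2 R u ≤ 4 R Δ`. -/
theorem IsSupportFun.dirRe_smoothedBoundary_le (H : IsSupportFun C h)
    (hR : ∀ z ∈ C, ‖z‖ ≤ R) (hR0 : 0 ≤ R) (hΔ : 0 < Δ) (hΔ1 : Δ ≤ 1) (t : ℝ) :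
    dirRe t (smoothedBoundary h Δ t) ≤ h t + 4 * R * Δ := by
  have hcont := H.continuous hR
  have hs : 0 < Real.sin Δ := Real.sin_pos_of_pos_of_lt_pi hΔ (by linarith [Real.pi_gt_three])
  rw [dirRe_smoothedBoundary hcont, div_le_iff₀ (by positivity), add_mul]
  nth_rw 1 [← integral_sin_sub_mul_cos]
  rw [← intervalIntegral.integral_const_mul]
  have : ∫ u in (0 : ℝ)..Δ, (4 * R * Δ * Real.sin Δ) = 4 * R * Δ * (Δ * Real.sin Δ) := by
    rw [intervalIntegral.integral_const]; simp; ring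
  rw [← this, ← intervalIntegral.integral_add]
  · apply intervalIntegral.integral_mono_on hΔ.le
    · apply Continuous.intervalIntegrable; fun_prop
    · apply Continuous.intervalIntegrable; fun_prop
    · intro u hu
      have h1 : 0 ≤ Real.sin (Δ - u) :=
        Real.sin_nonneg_of_nonneg_of_le_pi (by linarith [hu.2])
          (by linarith [hu.1, Real.pi_gt_three])
      have h2 : Real.sin (Δ - u) ≤ Real.sin Δ :=
        Real.sin_le_sin_of_le_of_le_pi_div_two (by linarith [hu.2, Real.pi_gt_three])
          (by linarith [Real.pi_gt_three]) (by linarith [hu.1])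
      have h3 := H.sub_le hR t (t + u)
      have h4 := H.sub_le hR t (t - u)
      rw [show t + u - t = u by ring, abs_of_nonneg hu.1] at h3
      rw [show t - u - t = -u by ring, abs_neg, abs_of_nonneg hu.1] at h4
      have h5 : (1 - Real.cos u) ≤ u := by
        have := Real.one_sub_sq_div_two_le_cos (x := u)
        nlinarith [hu.1, hu.2]
      have h6 := H.abs_le hR t
      have h7 : 2 * (1 - Real.cos u) * h t ≤ 2 * u * R := by
        have : 0 ≤ 1 - Real.cos u := by linarith [Real.cos_le_one u]
        calc 2 * (1 - Real.cos u) * h t ≤ 2 * (1 - Real.cos u) * R := by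
              gcongr; exact le_of_abs_le h6
          _ ≤ _ := by gcongr
      have h8 : h (t + u) + h (t - u) - 2 * Real.cos u * h t ≤ 4 * R * Δ := by
        have : R * u ≤ R * Δ := by gcongr; exact hu.2
        linarith
      have h9 : Real.sin (Δ - u) * (h (t + u) + h (t - u) - 2 * Real.cos u * h t) ≤
          Real.sin Δ * (4 * R * Δ) := by
        calc _ ≤ Real.sin (Δ - u) * (4 * R * Δ) := by gcongr
          _ ≤ _ := by gcongr
      linarith
  · apply Continuous.intervalIntegrable; fun_prop
  · apply Continuous.intervalIntegrable; fun_prop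

end

/-- A closed `C¹` curve, parametrized by the angle of its outer normal, that winds once around
`C` in the direction-wise distance `η` and stays inside `U`. -/
structure IsConvexContour (C U : Set ℂ) (η : ℝ) (σ : ℝ → ℂ) (ρ : ℝ → ℝ) : Prop where
  continuous_density : Continuous ρ
  density_nonneg : ∀ t, 0 ≤ ρ t
  hasDerivAt : ∀ t : ℝ, HasDerivAt σ (Complex.I * Complex.exp (t * Complex.I) * ρ t) t
  periodic : ∀ t, σ (t + 2 * Real.pi) = σ t
  mem : ∀ t, σ t ∈ U
  dirRe_le : ∀ z ∈ C, ∀ t, dirRe t z + η ≤ dirRe t (σ t)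

/-- Along a curve with outer normal `e^{it}` at time `t`, the maximum of the component in direction
`e^{iφ}` is attained at `φ`. -/
theorem dirRe_le_of_hasDerivAt {σ : ℝ → ℂ} {ρ : ℝ → ℝ} (hρ : ∀ t, 0 ≤ ρ t)
    (hσ : ∀ t : ℝ, HasDerivAt σ (Complex.I * Complex.exp (t * Complex.I) * ρ t) t)
    (hper : ∀ t, σ (t + 2 * Real.pi) = σ t) (φ t : ℝ) : dirRe φ (σ t) ≤ dirRe φ (σ φ) := by
  have hd : ∀ s, HasDerivAt (fun s => dirRe φ (σ s)) (Real.sin (φ - s) * ρ s) s := by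
    intro s
    have := (dirRe φ).hasFDerivAt.comp_hasDerivAt s (hσ s)
    refine this.congr_deriv ?_
    rw [dirRe_apply, Real.sin_sub]
    simp [Complex.exp_ofReal_mul_I_re, Complex.exp_ofReal_mul_I_im]
    ring
  have hcont : Continuous fun s => dirRe φ (σ s) :=
    continuous_iff_continuousAt.2 fun s => (hd s).continuousAt
  have hper' : Function.Periodic (fun s => dirRe φ (σ s)) (2 * Real.pi) := fun s => by
    simp only [hper]
  obtain ⟨s, hs, hst⟩ := hper'.exists_mem_Ico Real.two_pi_pos t (φ - Real.pi)
  rw [show dirRe φ (σ t) = dirRe φ (σ s) from hst]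
  rcases le_total s φ with hle | hle
  · have : MonotoneOn (fun s => dirRe φ (σ s)) (Set.Icc (φ - Real.pi) φ) := by
      apply monotoneOn_of_deriv_nonneg (convex_Icc _ _) hcont.continuousOn
      · exact fun s _ => (hd s).differentiableAt.differentiableWithinAt
      · intro s hs
        rw [interior_Icc] at hs
        rw [(hd s).deriv]
        exact mul_nonneg (Real.sin_nonneg_of_nonneg_of_le_pi (by linarith [hs.2])
          (by linarith [hs.1])) (hρ s)
    exact this ⟨hs.1, hle⟩ ⟨by linarith [Real.pi_pos], le_rfl⟩ hle
  · have : AntitoneOn (fun s => dirRe φ (σ s)) (Set.Icc φ (φ + Real.pi)) := by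
      apply antitoneOn_of_deriv_nonpos (convex_Icc _ _) hcont.continuousOn
      · exact fun s _ => (hd s).differentiableAt.differentiableWithinAt
      · intro s hs
        rw [interior_Icc] at hs
        rw [(hd s).deriv]
        exact mul_nonpos_of_nonpos_of_nonneg (Real.sin_nonpos_of_nonpos_of_neg_pi_le
          (by linarith [hs.1]) (by linarith [hs.2])) (hρ s)
    exact this ⟨le_rfl, by linarith [Real.pi_pos]⟩ ⟨hle, by linarith [hs.2]⟩ hle

/-- Let `p` be the point of `C` nearest to `w`. In the direction of `w - p` the set `C` does not
reach beyond `p`, so the excess of `w` over `h` in that direction is at least the distance `‖w -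
p‖`. -/
theorem IsSupportFun.mem_thickening {C : Set ℂ} {h : ℝ → ℝ} (H : IsSupportFun C h)
    (hC : IsCompact C) (hconv : Convex ℝ C) {w : ℂ} {δ : ℝ} (hδ : 0 < δ)
    (hw : ∀ φ, dirRe φ w < h φ + δ) : w ∈ Metric.thickening δ C := by
  obtain ⟨a, ha, -⟩ := H.attained 0
  obtain ⟨p, hp, hpmin⟩ := exists_norm_eq_iInf_of_complete_convex ⟨a, ha⟩ hC.isComplete hconv w
  have hin := (norm_eq_iInf_iff_real_inner_le_zero hconv hp).1 hpmin
  rw [Metric.mem_thickening_iff]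
  refine ⟨p, hp, ?_⟩
  rw [dist_eq_norm]
  set φ := Complex.arg (w - p)
  have hdir : ∀ z : ℂ, ‖w - p‖ * dirRe φ z = inner ℝ (w - p) z := by
    intro z
    rw [dirRe_apply, Complex.inner]
    have h1 := Complex.norm_mul_cos_arg (w - p)
    have h2 := Complex.norm_mul_sin_arg (w - p)
    rw [mul_add, ← mul_assoc, ← mul_assoc, h1, h2]
    simp [Complex.mul_re]
    ring
  by_cases hv : w - p = 0
  · rw [hv, norm_zero]; exact hδ
  have hpos : 0 < ‖w - p‖ := norm_pos_iff.2 hv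
  obtain ⟨b, hb, hbφ⟩ := H.attained φ
  have h1 : dirRe φ (b - p) ≤ 0 := by
    have := hin b hb
    rw [← hdir] at this
    exact nonpos_of_mul_nonpos_right this hpos
  have h2 : dirRe φ (w - p) = ‖w - p‖ := by
    have := hdir (w - p)
    rw [real_inner_self_eq_norm_mul_norm] at this
    exact mul_left_cancel₀ hpos.ne' this
  have h3 := hw φ
  rw [map_sub] at h1 h2
  linarith

theorem exists_isConvexContour {C : Set ℂ} (hC : IsCompact C) (hconv : Convex ℝ C)
    (hne : C.Nonempty) {δ : ℝ} (hδ : 0 < δ) :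
    ∃ η > 0, ∃ σ ρ, IsConvexContour C (Metric.thickening δ C) η σ ρ := by
  obtain ⟨h, H⟩ := hC.exists_isSupportFun hne
  obtain ⟨R, hR0, hR⟩ : ∃ R : ℝ, 0 ≤ R ∧ ∀ z ∈ C, ‖z‖ ≤ R := by
    obtain ⟨R, hR⟩ := hC.isBounded.exists_norm_le
    exact ⟨max R 0, le_max_right _ _, fun z hz => (hR z hz).trans (le_max_left _ _)⟩
  obtain ⟨Δ, hΔ, hΔ1, hΔR⟩ : ∃ Δ : ℝ, 0 < Δ ∧ Δ ≤ 1 ∧ 4 * R * Δ ≤ δ / 4 := by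
    refine ⟨min 1 (δ / (16 * R + 1)), by positivity, min_le_left _ _, ?_⟩
    calc 4 * R * min 1 (δ / (16 * R + 1)) ≤ 4 * R * (δ / (16 * R + 1)) := by
          gcongr; exact min_le_right _ _
      _ ≤ δ / 4 := by
          rw [mul_div_assoc', div_le_div_iff₀ (by positivity) (by positivity)]
          nlinarith
  have hcont := H.continuous hR
  have hs : 0 < Real.sin Δ := Real.sin_pos_of_pos_of_lt_pi hΔ (by linarith [Real.pi_gt_three])
  -- The smoothed curve already encloses `C`; moving it outwards by `δ / 2` gives the uniform gap `η
  -- = δ / 2`. The smoothing error is at most `δ / 4`, so the curve stays within `δ` of `C`.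
  set σ : ℝ → ℂ := fun t => smoothedBoundary h Δ t + (δ / 2 : ℝ) * Complex.exp (t * Complex.I)
  set ρ : ℝ → ℝ := fun t =>
    (h (t + Δ) + h (t - Δ) - 2 * Real.cos Δ * h t) / (Δ * Real.sin Δ) + δ / 2
  have hρ : ∀ t, 0 ≤ ρ t := fun t => by
    have := H.two_mul_cos_mul_le t Δ
    have : 0 ≤ h (t + Δ) + h (t - Δ) - 2 * Real.cos Δ * h t := by linarith
    positivity
  have hσ : ∀ t : ℝ, HasDerivAt σ (Complex.I * Complex.exp (t * Complex.I) * ρ t) t := by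
    intro t
    have h1 : HasDerivAt (fun t : ℝ => Complex.exp (t * Complex.I))
        (Complex.exp (t * Complex.I) * (1 * Complex.I)) t :=
      ((Complex.ofRealCLM.hasDerivAt (x := t)).mul_const Complex.I).cexp
    refine ((hasDerivAt_smoothedBoundary hcont Δ t).add
      (h1.const_mul ((δ / 2 : ℝ) : ℂ))).congr_deriv ?_
    simp only [ρ]
    push_cast
    ring
  have hper : ∀ t, σ (t + 2 * Real.pi) = σ t := by
    intro t
    simp only [σ]
    rw [smoothedBoundary_add_two_pi H.add_two_pi]
    congr 2
    push_cast
    rw [add_mul]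
    exact Complex.exp_periodic _
  have hdir : ∀ t : ℝ, dirRe t (Complex.exp (t * Complex.I)) = 1 := by
    intro t
    rw [dirRe_eq_re, ← Complex.exp_add]
    simp
  have hdir' : ∀ t : ℝ, dirRe t (σ t) = dirRe t (smoothedBoundary h Δ t) + δ / 2 := by
    intro t
    simp only [σ]
    rw [map_add, ← smul_eq_mul, Complex.coe_smul, map_smul, hdir]
    simp
  refine ⟨δ / 2, by positivity, σ, ρ, ?_, hρ, hσ, hper, ?_, ?_⟩
  · simp only [ρ]; fun_prop
  · intro t
    apply H.mem_thickening hC hconv hδ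
    intro φ
    have h1 := dirRe_le_of_hasDerivAt hρ hσ hper φ t
    have h2 := H.dirRe_smoothedBoundary_le hR hR0 hΔ hΔ1 φ
    rw [hdir'] at h1
    linarith
  · intro z hz t
    rw [hdir']
    have := H.le_dirRe_smoothedBoundary hR hΔ hΔ1 hz t
    linarith

end

/-! ### The Cauchy kernel and Cauchy transforms along a convex contour. -/

noncomputable section

open Complex in
/-- The Cauchy kernel `σ'(t) / (2πi (σ(t) - z))` of a contour with `σ'(t) = i e^{it} ρ(t)`. -/
def contourKernel (σ : ℝ → ℂ) (ρ : ℝ → ℝ) (t : ℝ) (z : ℂ) : ℂ :=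
  exp (t * I) * ρ t / (2 * Real.pi) / (σ t - z)

namespace IsConvexContour

variable {C U : Set ℂ} {η : ℝ} {σ : ℝ → ℂ} {ρ : ℝ → ℝ}

theorem continuous (K : IsConvexContour C U η σ ρ) : Continuous σ :=
  continuous_iff_continuousAt.2 fun s => (K.hasDerivAt s).continuousAt

theorem le_norm_sub (K : IsConvexContour C U η σ ρ) {p : ℂ} (hp : p ∈ C) (z : ℂ) (t : ℝ) :
    η - dist z p ≤ dirRe t (σ t - z) := by
  have h1 := K.dirRe_le p hp t
  have h2 := dirRe_le_norm t (z - p)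
  rw [dist_eq_norm]
  rw [map_sub] at h2 ⊢
  linarith

theorem dirRe_sub_pos (K : IsConvexContour C U η σ ρ) {z : ℂ}
    (hz : z ∈ Metric.thickening η C) (t : ℝ) : 0 < dirRe t (σ t - z) := by
  obtain ⟨p, hp, hzp⟩ := Metric.mem_thickening_iff.1 hz
  have := K.le_norm_sub hp z t
  linarith

theorem sub_ne_zero (K : IsConvexContour C U η σ ρ) {z : ℂ}
    (hz : z ∈ Metric.thickening η C) (t : ℝ) : σ t - z ≠ 0 := by
  intro h0
  have := K.dirRe_sub_pos hz t
  rw [h0, map_zero] at this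
  exact lt_irrefl _ this

theorem continuous_kernel (K : IsConvexContour C U η σ ρ) {z : ℂ}
    (hz : z ∈ Metric.thickening η C) : Continuous fun t => contourKernel σ ρ t z := by
  have h1 := K.continuous
  have h2 := K.continuous_density
  unfold contourKernel
  apply Continuous.div₀ (by fun_prop) (by fun_prop)
  exact fun t => K.sub_ne_zero hz t

/-- The kernel is `ρ / 2π` times the inverse of `e^{-it} (σ t - z)`, which lies in the right half
plane because the contour is beyond `z` in its own normal direction. -/
theorem kernel_re_nonneg (K : IsConvexContour C U η σ ρ) {z : ℂ}
    (hz : z ∈ Metric.thickening η C) (t : ℝ) : 0 ≤ (contourKernel σ ρ t z).re := by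
  have hpos := K.dirRe_sub_pos hz t
  have h0 := K.sub_ne_zero hz t
  have hρ := K.density_nonneg t
  rw [dirRe_eq_re] at hpos
  set w := σ t - z
  have : contourKernel σ ρ t z = ((ρ t / (2 * Real.pi) : ℝ) : ℂ) *
      (Complex.exp (-(t * Complex.I)) * w)⁻¹ := by
    unfold contourKernel
    rw [mul_inv, ← Complex.exp_neg, neg_neg]
    push_cast
    ring
  rw [this, Complex.re_ofReal_mul, Complex.inv_re]
  have := Complex.normSq_nonneg (Complex.exp (-(t * Complex.I)) * w)
  have := Real.pi_pos
  positivity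

/-- After rotation by `e^{-it}` the vector `σ t - z` stays in the right half plane, so the principal
logarithm is a smooth primitive. The compensating term `t * I` collects the winding number 1. -/
theorem integral_kernel (K : IsConvexContour C U η σ ρ) {z : ℂ}
    (hz : z ∈ Metric.thickening η C) :
    ∫ t in (0 : ℝ)..2 * Real.pi, contourKernel σ ρ t z = 1 := by
  have hd : ∀ t ∈ Set.uIcc 0 (2 * Real.pi), HasDerivAt (fun t : ℝ =>
      (Complex.log (Complex.exp (-(t * Complex.I)) * (σ t - z)) + t * Complex.I) /
        (2 * Real.pi * Complex.I)) (contourKernel σ ρ t z) t := by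
    intro t _
    have h1 : HasDerivAt (fun t : ℝ => (t : ℂ) * Complex.I) (1 * Complex.I) t :=
      (Complex.ofRealCLM.hasDerivAt (x := t)).mul_const Complex.I
    have h2 := h1.neg.cexp.mul ((K.hasDerivAt t).sub_const z)
    have h3 := h2.clog_real (Or.inl (by
      have := K.dirRe_sub_pos hz t
      rwa [dirRe_eq_re] at this))
    refine ((h3.add h1).div_const (2 * Real.pi * Complex.I)).congr_deriv ?_
    have h0 := K.sub_ne_zero hz t
    have hpi : (Real.pi : ℂ) ≠ 0 := by exact_mod_cast Real.pi_ne_zero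
    simp only [Pi.mul_apply, Pi.neg_apply, contourKernel]
    have he : Complex.exp (-(t * Complex.I)) ≠ 0 := Complex.exp_ne_zero _
    field_simp
    ring
  rw [intervalIntegral.integral_eq_sub_of_hasDerivAt hd
    ((K.continuous_kernel hz).intervalIntegrable _ _)]
  have hper := K.periodic 0
  rw [zero_add] at hper
  rw [hper]
  have e1 : Complex.exp (-(((2 * Real.pi : ℝ) : ℂ) * Complex.I)) = 1 := by
    rw [Complex.exp_neg]
    push_cast
    rw [Complex.exp_two_pi_mul_I, inv_one]
  rw [e1]
  have hpi : (Real.pi : ℂ) ≠ 0 := by exact_mod_cast Real.pi_ne_zero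
  simp
  field_simp
  simp

/-- Cauchy's formula: the difference quotient of `f` at `z` is holomorphic on the convex set `U`, so
it has a primitive and its integral over the closed curve vanishes. What remains is `f z` times the
mass of the kernel. -/
theorem integral_mul_kernel (K : IsConvexContour C U η σ ρ) (hU : IsOpen U)
    (hUc : Convex ℝ U) {f : ℂ → ℂ} (hf : DifferentiableOn ℂ f U) {z : ℂ} (hzU : z ∈ U)
    (hz : z ∈ Metric.thickening η C) :
    ∫ t in (0 : ℝ)..2 * Real.pi, f (σ t) * contourKernel σ ρ t z = f z := by
  have hds : DifferentiableOn ℂ (dslope f z) U :=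
    (Complex.differentiableOn_dslope (hU.mem_nhds hzU)).2 hf
  obtain ⟨g, hg⟩ := hUc.exists_forall_hasDerivWithinAt hds
  have hσc := K.continuous
  have hρc := K.continuous_density
  have hfc : Continuous fun t => f (σ t) := hf.continuousOn.comp_continuous hσc K.mem
  have hdc : Continuous fun t => dslope f z (σ t) := hds.continuousOn.comp_continuous hσc K.mem
  have hgd : ∀ t ∈ Set.uIcc 0 (2 * Real.pi), HasDerivAt (fun t => g (σ t))
      (dslope f z (σ t) * (Complex.I * Complex.exp (t * Complex.I) * ρ t)) t := by
    intro t _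
    have h1 := (hg _ (K.mem t)).hasDerivAt (hU.mem_nhds (K.mem t))
    exact h1.comp t (K.hasDerivAt t)
  have hint := intervalIntegral.integral_eq_sub_of_hasDerivAt hgd
    (by apply Continuous.intervalIntegrable; fun_prop)
  have hper := K.periodic 0
  rw [zero_add] at hper
  rw [hper, sub_self] at hint
  have hkc := K.continuous_kernel hz
  have hpi : (Real.pi : ℂ) ≠ 0 := by exact_mod_cast Real.pi_ne_zero
  have e : ∀ t, f (σ t) * contourKernel σ ρ t z = f z * contourKernel σ ρ t z +
      (2 * Real.pi * Complex.I)⁻¹ *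
        (dslope f z (σ t) * (Complex.I * Complex.exp (t * Complex.I) * ρ t)) := by
    intro t
    have h0 := K.sub_ne_zero hz t
    rw [dslope_of_ne _ (_root_.sub_ne_zero.1 h0), slope_def_field, contourKernel]
    field_simp
    ring
  simp only [e]
  rw [intervalIntegral.integral_add, intervalIntegral.integral_const_mul,
    intervalIntegral.integral_const_mul, hint, K.integral_kernel hz]
  · simp
  · apply Continuous.intervalIntegrable; fun_prop
  · apply Continuous.intervalIntegrable; fun_prop

/-- The Cauchy transform of a continuous function along the contour is holomorphic near `C`. -/
theorem differentiableOn_integral_mul_kernel (K : IsConvexContour C U η σ ρ) {F : ℝ → ℂ}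
    (hF : Continuous F) : DifferentiableOn ℂ
      (fun z => ∫ t in (0 : ℝ)..2 * Real.pi, F t * contourKernel σ ρ t z)
      (Metric.thickening η C) := by
  intro z hz
  obtain ⟨p, hp, hzp⟩ := Metric.mem_thickening_iff.1 hz
  set r := (η - dist z p) / 2 with hr
  have hr0 : 0 < r := by rw [hr]; linarith
  have hball : ∀ w ∈ Metric.ball z r, w ∈ Metric.thickening η C ∧ ∀ t, r ≤ ‖σ t - w‖ := by
    intro w hw
    have h1 := dist_triangle w z p
    rw [Metric.mem_ball] at hw
    refine ⟨Metric.mem_thickening_iff.2 ⟨p, hp, by linarith⟩, fun t => ?_⟩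
    have h2 := K.le_norm_sub hp w t
    have h3 := dirRe_le_norm t (σ t - w)
    linarith
  have hσc := K.continuous
  have hρc := K.continuous_density
  have hzne := fun t => K.sub_ne_zero hz t
  have hc' : Continuous fun t : ℝ => F t * (Complex.exp (t * Complex.I) * ρ t / (2 * Real.pi) /
      (σ t - z) ^ 2) := by
    apply hF.mul (Continuous.div₀ (by fun_prop) (by fun_prop) fun t => pow_ne_zero _ (hzne t))
  refine DifferentiableAt.differentiableWithinAt (HasDerivAt.differentiableAt
    (intervalIntegral.hasDerivAt_integral_of_dominated_loc_of_deriv_le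
      (F' := fun z t => F t * (Complex.exp (t * Complex.I) * ρ t / (2 * Real.pi) /
        (σ t - z) ^ 2))
      (bound := fun t => ‖F t * (Complex.exp (t * Complex.I) * ρ t / (2 * Real.pi))‖ / r ^ 2)
      (Metric.ball_mem_nhds z hr0) ?_ ?_ ?_ ?_ ?_ ?_).2)
  · filter_upwards [Metric.ball_mem_nhds z hr0] with w hw
    exact (hF.mul (K.continuous_kernel (hball w hw).1)).aestronglyMeasurable
  · exact (hF.mul (K.continuous_kernel hz)).intervalIntegrable _ _
  · exact hc'.aestronglyMeasurable
  · refine Filter.Eventually.of_forall fun t _ w hw => ?_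
    rw [← mul_div_assoc, norm_div, norm_pow]
    gcongr
    exact (hball w hw).2 t
  · apply Continuous.intervalIntegrable
    fun_prop
  · refine Filter.Eventually.of_forall fun t _ w hw => ?_
    have hne := K.sub_ne_zero (hball w hw).1 t
    have h1 := (((hasDerivAt_id w).const_sub (σ t)).inv hne).const_mul
      (F t * (Complex.exp (t * Complex.I) * ρ t / (2 * Real.pi)))
    refine (h1.congr_deriv ?_).congr_of_eventuallyEq (Filter.Eventually.of_forall fun x => ?_)
    · simp; ring
    · simp [contourKernel]; ring

/-- Adding the conjugate kernel turns the weight into `2 Re`, nonnegative of mass 2, which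
contributes at most 2. The added integral is the conjugate of Cauchy's formula, hence at most 1 in
modulus. The total 3 is crude but needs no boundary values of the transform. -/
theorem norm_integral_conj_mul_kernel_le (K : IsConvexContour C U η σ ρ) (hU : IsOpen U)
    (hUc : Convex ℝ U) {f : ℂ → ℂ} (hf : DifferentiableOn ℂ f U) (hf1 : ∀ z ∈ U, ‖f z‖ ≤ 1)
    {z : ℂ} (hzU : z ∈ U) (hz : z ∈ Metric.thickening η C) :
    ‖∫ t in (0 : ℝ)..2 * Real.pi, (starRingEnd ℂ) (f (σ t)) * contourKernel σ ρ t z‖ ≤ 3 := by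
  have hσc := K.continuous
  have hfc : Continuous fun t => f (σ t) := hf.continuousOn.comp_continuous hσc K.mem
  have hkc := K.continuous_kernel hz
  have hcauchy := K.integral_mul_kernel hU hUc hf hzU hz
  have hcc : Continuous fun t => (starRingEnd ℂ) (f (σ t)) := Complex.continuous_conj.comp hfc
  have hkk : Continuous fun t => (starRingEnd ℂ) (contourKernel σ ρ t z) :=
    Complex.continuous_conj.comp hkc
  have hconj : ∫ t in (0 : ℝ)..2 * Real.pi,
      (starRingEnd ℂ) (f (σ t)) * (starRingEnd ℂ) (contourKernel σ ρ t z) =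
        (starRingEnd ℂ) (f z) := by
    rw [← hcauchy, ← intervalIntegral.intervalIntegral_conj]
    simp only [map_mul]
  have hre : ∫ t in (0 : ℝ)..2 * Real.pi, (contourKernel σ ρ t z).re = 1 := by
    have := Complex.reCLM.intervalIntegral_comp_comm
      (hkc.intervalIntegrable (μ := MeasureTheory.volume) 0 (2 * Real.pi))
    rw [K.integral_kernel hz] at this
    simpa using this
  have hsum : ‖∫ t in (0 : ℝ)..2 * Real.pi,
      ((starRingEnd ℂ) (f (σ t)) * contourKernel σ ρ t z +
        (starRingEnd ℂ) (f (σ t)) * (starRingEnd ℂ) (contourKernel σ ρ t z))‖ ≤ 2 := by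
    have : ∫ t in (0 : ℝ)..2 * Real.pi, 2 * (contourKernel σ ρ t z).re = 2 := by
      rw [intervalIntegral.integral_const_mul, hre, mul_one]
    refine le_trans ?_ this.le
    apply intervalIntegral.norm_integral_le_of_norm_le Real.two_pi_pos.le
    · refine Filter.Eventually.of_forall fun t _ => ?_
      rw [← mul_add, Complex.add_conj, norm_mul, RCLike.norm_conj, Complex.norm_real,
        Real.norm_eq_abs, abs_of_nonneg (by have := K.kernel_re_nonneg hz t; positivity)]
      have h1 := hf1 _ (K.mem t)
      have h2 := K.kernel_re_nonneg hz t
      nlinarith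
    · apply Continuous.intervalIntegrable
      have := Complex.continuous_re.comp hkc
      exact this.const_mul 2
  rw [intervalIntegral.integral_add, hconj] at hsum
  · have h1 := norm_sub_le ((∫ t in (0 : ℝ)..2 * Real.pi,
      (starRingEnd ℂ) (f (σ t)) * contourKernel σ ρ t z) + (starRingEnd ℂ) (f z))
      ((starRingEnd ℂ) (f z))
    rw [add_sub_cancel_right, RCLike.norm_conj] at h1
    linarith [hf1 z hzU]
  · exact (hcc.mul hkc).intervalIntegrable _ _
  · exact (hcc.mul hkk).intervalIntegrable _ _

end IsConvexContour

end

/-! ### The numerical range as a 3-spectral set, for diagonalized operators. -/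

noncomputable section

section

variable {H : Type*} [NormedAddCommGroup H] [InnerProductSpace ℂ H]

open scoped InnerProductSpace

theorem ContinuousLinearMap.norm_le_two_of_norm_inner_le {S : H →L[ℂ] H}
    (hS : ∀ x y, ‖⟪y, S x⟫_ℂ‖ ≤ ‖x‖ ^ 2 + ‖y‖ ^ 2) : ‖S‖ ≤ 2 := by
  refine ContinuousLinearMap.opNorm_le_of_unit_norm (by norm_num) fun x hx => ?_
  by_cases h0 : S x = 0
  · rw [h0, norm_zero]; norm_num
  have hpos : 0 < ‖S x‖ := norm_pos_iff.2 h0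
  have h1 := hS x (((‖S x‖⁻¹ : ℝ) : ℂ) • S x)
  rw [inner_smul_left, inner_self_eq_norm_sq_to_K, norm_smul] at h1
  simp only [Complex.conj_ofReal, norm_mul, norm_pow, Complex.norm_real, Complex.coe_algebraMap,
    norm_inv, norm_norm] at h1
  rw [inv_mul_cancel₀ hpos.ne', hx, pow_two, ← mul_assoc, inv_mul_cancel₀ hpos.ne', one_mul] at h1
  linarith

/-- Expand the form at `c • x - y`, where the phase `c` makes the cross term equal to its modulus.
This additive form of Cauchy-Schwarz can be integrated directly. -/
theorem ContinuousLinearMap.IsPositive.norm_inner_le {M : H →L[ℂ] H} (hM : M.IsPositive)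
    (x y : H) : 2 * ‖⟪y, M x⟫_ℂ‖ ≤ (⟪x, M x⟫_ℂ).re + (⟪y, M y⟫_ℂ).re := by
  obtain ⟨c, hc1, hc2⟩ : ∃ c : ℂ, ‖c‖ = 1 ∧ c * ⟪y, M x⟫_ℂ = ‖⟪y, M x⟫_ℂ‖ := by
    by_cases h0 : ⟪y, M x⟫_ℂ = 0
    · exact ⟨1, by simp, by simp [h0]⟩
    · have : (‖⟪y, M x⟫_ℂ‖ : ℂ) ≠ 0 := by simpa using h0
      refine ⟨‖⟪y, M x⟫_ℂ‖ / ⟪y, M x⟫_ℂ, ?_, div_mul_cancel₀ _ h0⟩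
      rw [norm_div, Complex.norm_real, norm_norm, div_self (by simpa using h0)]
  have h1 := hM.re_inner_nonneg_right (c • x - y)
  have hsymm : ⟪x, M y⟫_ℂ = (starRingEnd ℂ) ⟪y, M x⟫_ℂ := by
    rw [inner_conj_symm]
    exact (hM.inner_left_eq_inner_right x y).symm
  have hcc : (starRingEnd ℂ) c * c = 1 := by
    rw [mul_comm, Complex.mul_conj, Complex.normSq_eq_norm_sq, hc1]; simp
  simp only [map_sub, map_smul, inner_sub_left, inner_sub_right, inner_smul_left,
    inner_smul_right, hsymm] at h1
  rw [← map_mul, hc2, Complex.conj_ofReal] at h1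
  rw [mul_sub, ← mul_assoc, mul_comm c, hcc, one_mul, hc2] at h1
  simp at h1
  linarith

variable [CompleteSpace H]

/-- A positive operator-valued density of total mass `2` integrates bounded functions to operators
of norm at most `2`. -/
theorem norm_integral_smul_le_two {M : ℝ → H →L[ℂ] H} (hMc : Continuous M)
    (hM : ∀ t, (M t).IsPositive) {a b : ℝ} (hab : a ≤ b) (hM2 : ∫ t in a..b, M t = 2)
    {f : ℝ → ℂ} (hf : Continuous f) (hf1 : ∀ t, ‖f t‖ ≤ 1) : ‖∫ t in a..b, f t • M t‖ ≤ 2 := by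
  apply ContinuousLinearMap.norm_le_two_of_norm_inner_le
  intro x y
  have hfM : Continuous fun t => f t • M t := hf.smul hMc
  have hmass : ∀ x, ∫ t in a..b, (⟪x, M t x⟫_ℂ).re = 2 * ‖x‖ ^ 2 := by
    intro x
    have h1 : (∫ t in a..b, M t) x = ∫ t in a..b, M t x :=
      ContinuousLinearMap.intervalIntegral_apply (hMc.intervalIntegrable _ _) x
    have hMx : Continuous fun t => M t x := hMc.clm_apply continuous_const
    have h2 : ∫ t in a..b, ⟪x, M t x⟫_ℂ = ⟪x, ∫ t in a..b, M t x⟫_ℂ :=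
      (innerSL ℂ x).intervalIntegral_comp_comm (hMx.intervalIntegrable _ _)
    have h3 := Complex.reCLM.intervalIntegral_comp_comm
      ((Continuous.inner (𝕜 := ℂ) (continuous_const (y := x)) hMx).intervalIntegrable
        (μ := MeasureTheory.volume) a b)
    simp only [Complex.reCLM_apply] at h3
    rw [h3, h2, ← h1, hM2]
    have : (2 : H →L[ℂ] H) x = (2 : ℂ) • x := by
      rw [← one_add_one_eq_two, add_apply, one_apply_eq_self,
        two_smul]
    rw [this, inner_smul_right, inner_self_eq_norm_sq_to_K]
    have h4 : ((2 : ℂ) * ((‖x‖ : ℝ) : ℂ) ^ 2).re = 2 * ‖x‖ ^ 2 := by norm_cast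
    exact h4
  have hint : ⟪y, (∫ t in a..b, f t • M t) x⟫_ℂ = ∫ t in a..b, f t * ⟪y, M t x⟫_ℂ := by
    rw [ContinuousLinearMap.intervalIntegral_apply (hfM.intervalIntegrable _ _) x]
    have h2 := (innerSL ℂ y).intervalIntegral_comp_comm
      ((hfM.clm_apply (continuous_const (y := x))).intervalIntegrable
        (μ := MeasureTheory.volume) a b)
    simp only [innerSL_apply_apply, smul_apply, inner_smul_right] at h2
    exact h2.symm
  have hcq : ∀ x, Continuous fun t => (⟪x, M t x⟫_ℂ).re := fun x =>
    Complex.continuous_re.comp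
      (Continuous.inner continuous_const (hMc.clm_apply continuous_const))
  rw [hint]
  calc ‖∫ t in a..b, f t * ⟪y, M t x⟫_ℂ‖
      ≤ ∫ t in a..b, ((⟪x, M t x⟫_ℂ).re / 2 + (⟪y, M t y⟫_ℂ).re / 2) := by
        apply intervalIntegral.norm_integral_le_of_norm_le hab
        · refine Filter.Eventually.of_forall fun t _ => ?_
          have h1 := (hM t).norm_inner_le x y
          rw [norm_mul]
          have h2 := hf1 t
          have h3 := norm_nonneg ⟪y, M t x⟫_ℂ
          nlinarith
        · exact (((hcq x).div_const 2).add ((hcq y).div_const 2)).intervalIntegrable _ _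
    _ = ‖x‖ ^ 2 + ‖y‖ ^ 2 := by
        rw [intervalIntegral.integral_add, intervalIntegral.integral_div,
          intervalIntegral.integral_div, hmass, hmass]
        · ring
        · exact ((hcq x).div_const 2).intervalIntegrable _ _
        · exact ((hcq y).div_const 2).intervalIntegrable _ _

/-- `B` is diagonalized by the complete system of orthogonal idempotents `P`. -/
structure IsSpectralResolution {ι : Type*} [Fintype ι] [DecidableEq ι] (B : H →L[ℂ] H)
    (lam : ι → ℂ) (P : ι → H →L[ℂ] H) : Prop where
  mul_eq : ∀ i j, P i * P j = if i = j then P i else 0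
  sum_eq : ∑ i, P i = 1
  eq_sum : B = ∑ i, lam i • P i

namespace IsSpectralResolution

variable {ι : Type*} [Fintype ι] [DecidableEq ι] {B : H →L[ℂ] H} {lam : ι → ℂ}
  {P : ι → H →L[ℂ] H}

theorem sum_smul_mul_sum_smul (D : IsSpectralResolution B lam P) (a b : ι → ℂ) :
    (∑ i, a i • P i) * (∑ i, b i • P i) = ∑ i, (a i * b i) • P i := by
  rw [Finset.sum_mul]
  refine Finset.sum_congr rfl fun i _ => ?_
  rw [Finset.mul_sum]
  simp [D.mul_eq, smul_smul, mul_comm]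

theorem smul_sub_mul_sum (D : IsSpectralResolution B lam P) {w : ℂ} (hw : ∀ i, w - lam i ≠ 0) :
    (w • (1 : H →L[ℂ] H) - B) * (∑ i, (w - lam i)⁻¹ • P i) = 1 := by
  have : w • (1 : H →L[ℂ] H) - B = ∑ i, (w - lam i) • P i := by
    simp only [sub_smul, Finset.sum_sub_distrib]
    rw [← D.eq_sum, ← Finset.smul_sum, D.sum_eq]
  rw [this, D.sum_smul_mul_sum_smul, ← D.sum_eq]
  refine Finset.sum_congr rfl fun i _ => ?_
  rw [mul_inv_cancel₀ (hw i), one_smul]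

variable {C U : Set ℂ} {η : ℝ} {σ : ℝ → ℂ} {ρ : ℝ → ℝ}

/-- The operator is twice the real part of `e^{it} ρ / 2π` times the resolvent `R`. With `u = R x`,
its form at `x` becomes a nonnegative multiple of the component of `‖u‖² σ t - ⟪u, B u⟫` in the
direction `e^{it}`, which is nonnegative since the numerical range of `B` lies behind the contour in
that direction. -/
theorem isPositive_kernel (D : IsSpectralResolution B lam P) (K : IsConvexContour C U η σ ρ)
    (hη : 0 < η) (hlam : ∀ i, lam i ∈ C) (hB : ∀ x, ‖x‖ = 1 → ⟪x, B x⟫_ℂ ∈ C) (t : ℝ) :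
    ((∑ i, contourKernel σ ρ t (lam i) • P i) +
      star (∑ i, contourKernel σ ρ t (lam i) • P i)).IsPositive := by
  have hmem : ∀ i, lam i ∈ Metric.thickening η C := fun i =>
    Metric.self_subset_thickening hη C (hlam i)
  set N := ∑ i, contourKernel σ ρ t (lam i) • P i with hN
  set R := ∑ i, (σ t - lam i)⁻¹ • P i with hR
  have hNR : N = (Complex.exp (t * Complex.I) * ρ t / (2 * Real.pi)) • R := by
    rw [hN, hR, Finset.smul_sum]
    refine Finset.sum_congr rfl fun i _ => ?_
    rw [smul_smul, contourKernel, div_eq_mul_inv _ (σ t - lam i)]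
  have hres : (σ t • (1 : H →L[ℂ] H) - B) * R = 1 :=
    D.smul_sub_mul_sum fun i => K.sub_ne_zero (hmem i) t
  have hre : ∀ x, 0 ≤ (⟪x, N x⟫_ℂ).re := by
    intro x
    set u := R x with hu
    have hx : x = σ t • u - B u := by
      have := congrArg (fun T : H →L[ℂ] H => T x) hres
      simpa using this.symm
    have hq : 0 ≤ dirRe t (σ t * (‖u‖ : ℂ) ^ 2 - ⟪u, B u⟫_ℂ) := by
      by_cases h0 : u = 0
      · simp [h0]
      have hpos : 0 < ‖u‖ := norm_pos_iff.2 h0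
      have h1 := hB (((‖u‖⁻¹ : ℝ) : ℂ) • u) (by
        rw [norm_smul, Complex.norm_real, norm_inv, norm_norm, inv_mul_cancel₀ hpos.ne'])
      rw [map_smul, inner_smul_left, inner_smul_right, Complex.conj_ofReal] at h1
      have h2 := K.dirRe_le _ h1 t
      have h3 : σ t * (‖u‖ : ℂ) ^ 2 - ⟪u, B u⟫_ℂ =
          (‖u‖ ^ 2) • (σ t - ((‖u‖⁻¹ : ℝ) : ℂ) * (((‖u‖⁻¹ : ℝ) : ℂ) * ⟪u, B u⟫_ℂ)) := by
        have : (‖u‖ : ℂ) ≠ 0 := by exact_mod_cast hpos.ne'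
        rw [← Complex.coe_smul, smul_eq_mul]
        push_cast
        field_simp
      rw [h3, map_smul, smul_eq_mul, map_sub]
      have : 0 ≤ dirRe t (σ t) -
          dirRe t (((‖u‖⁻¹ : ℝ) : ℂ) * (((‖u‖⁻¹ : ℝ) : ℂ) * ⟪u, B u⟫_ℂ)) := by linarith
      positivity
    have h4 : ⟪x, N x⟫_ℂ = ((ρ t / (2 * Real.pi) : ℝ) : ℂ) *
        (starRingEnd ℂ) (Complex.exp (-(t * Complex.I)) *
          (σ t * (‖u‖ : ℂ) ^ 2 - ⟪u, B u⟫_ℂ)) := by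
      rw [hNR, smul_apply, ← hu, inner_smul_right]
      nth_rw 1 [hx]
      rw [inner_sub_left, inner_smul_left, map_mul, map_sub, map_mul, inner_conj_symm,
        ← Complex.exp_conj, inner_self_eq_norm_sq_to_K]
      simp
      ring
    rw [h4, Complex.re_ofReal_mul, Complex.conj_re, ← dirRe_eq_re]
    have := K.density_nonneg t
    have := Real.pi_pos
    positivity
  have hsa : IsSelfAdjoint (N + star N) := IsSelfAdjoint.add_star_self N
  rw [ContinuousLinearMap.isPositive_iff_complex]
  intro x
  have hin : ⟪(N + star N) x, x⟫_ℂ = ((2 * (⟪x, N x⟫_ℂ).re : ℝ) : ℂ) := by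
    rw [add_apply, inner_add_left, ContinuousLinearMap.star_eq_adjoint,
      ContinuousLinearMap.adjoint_inner_left, ← inner_conj_symm (N x) x, add_comm,
      Complex.add_conj]
  have := hre x
  rw [hin]
  simp
  positivity

/-- With `g` the Cauchy transform of the conjugate of `f`, the operator `f(B) + g(B)ᴴ` has norm
at most `2`. -/
theorem norm_add_star_le_two (D : IsSpectralResolution B lam P) (K : IsConvexContour C U η σ ρ)
    (hη : 0 < η) (hU : IsOpen U) (hUc : Convex ℝ U) (hCU : C ⊆ U) (hlam : ∀ i, lam i ∈ C)
    (hB : ∀ x, ‖x‖ = 1 → ⟪x, B x⟫_ℂ ∈ C) {f : ℂ → ℂ} (hf : DifferentiableOn ℂ f U)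
    (hf1 : ∀ z ∈ U, ‖f z‖ ≤ 1) :
    ‖(∑ i, f (lam i) • P i) + star (∑ i, (∫ t in (0 : ℝ)..2 * Real.pi,
      (starRingEnd ℂ) (f (σ t)) * contourKernel σ ρ t (lam i)) • P i)‖ ≤ 2 := by
  have hmem : ∀ i, lam i ∈ Metric.thickening η C := fun i =>
    Metric.self_subset_thickening hη C (hlam i)
  have hσc := K.continuous
  have hfc : Continuous fun t => f (σ t) := hf.continuousOn.comp_continuous hσc K.mem
  have hkc := fun i => K.continuous_kernel (hmem i)
  set M : ℝ → H →L[ℂ] H := fun t => (∑ i, contourKernel σ ρ t (lam i) • P i) +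
      star (∑ i, contourKernel σ ρ t (lam i) • P i) with hMdef
  have hstar : ∀ c : ι → ℂ, star (∑ i, c i • P i) = ∑ i, (starRingEnd ℂ) (c i) • star (P i) := by
    intro c
    rw [star_sum]
    exact Finset.sum_congr rfl fun i _ => star_smul _ _
  have hM : ∀ t, M t = (∑ i, contourKernel σ ρ t (lam i) • P i) +
      ∑ i, (starRingEnd ℂ) (contourKernel σ ρ t (lam i)) • star (P i) := fun t => by
    rw [hMdef]; simp only [hstar]
  have hkk : ∀ i, Continuous fun t => (starRingEnd ℂ) (contourKernel σ ρ t (lam i)) := fun i =>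
    Complex.continuous_conj.comp (hkc i)
  have hMc : Continuous M := by
    rw [funext hM]
    refine (continuous_finsetSum _ fun i _ => (hkc i).smul continuous_const).add
      (continuous_finsetSum _ fun i _ => (hkk i).smul continuous_const)
  have hinteg : ∀ φ : ℝ → ℂ, Continuous φ → ∫ t in (0 : ℝ)..2 * Real.pi, φ t • M t =
      (∑ i, (∫ t in (0 : ℝ)..2 * Real.pi, φ t * contourKernel σ ρ t (lam i)) • P i) +
      ∑ i, (∫ t in (0 : ℝ)..2 * Real.pi,
        φ t * (starRingEnd ℂ) (contourKernel σ ρ t (lam i))) • star (P i) := by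
    intro φ hφ
    simp only [hM, smul_add, Finset.smul_sum, smul_smul]
    have hi1 : ∀ i, Continuous fun t => (φ t * contourKernel σ ρ t (lam i)) • P i := fun i =>
      (hφ.mul (hkc i)).smul continuous_const
    have hi2 : ∀ i, Continuous fun t =>
        (φ t * (starRingEnd ℂ) (contourKernel σ ρ t (lam i))) • star (P i) := fun i =>
      (hφ.mul (hkk i)).smul continuous_const
    rw [intervalIntegral.integral_add, intervalIntegral.integral_finsetSum,
      intervalIntegral.integral_finsetSum]
    · simp only [intervalIntegral.integral_smul_const]
    · exact fun i _ => (hi2 i).intervalIntegrable _ _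
    · exact fun i _ => (hi1 i).intervalIntegrable _ _
    · exact (continuous_finsetSum _ fun i _ => hi1 i).intervalIntegrable _ _
    · exact (continuous_finsetSum _ fun i _ => hi2 i).intervalIntegrable _ _
  have hM2 : ∫ t in (0 : ℝ)..2 * Real.pi, M t = 2 := by
    have := hinteg (fun _ => 1) continuous_const
    simp only [one_smul, one_mul, intervalIntegral.intervalIntegral_conj,
      fun i => K.integral_kernel (hmem i), map_one] at this
    rw [this, ← star_sum, D.sum_eq, star_one, one_add_one_eq_two]
  have key := norm_integral_smul_le_two hMc
    (fun t => D.isPositive_kernel K hη hlam hB t) Real.two_pi_pos.le hM2 hfc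
    (fun t => hf1 _ (K.mem t))
  rw [hinteg _ hfc] at key
  have e1 : ∀ i, ∫ t in (0 : ℝ)..2 * Real.pi, f (σ t) * contourKernel σ ρ t (lam i) =
      f (lam i) := fun i => K.integral_mul_kernel hU hUc hf (hCU (hlam i)) (hmem i)
  have e2 : ∀ i, ∫ t in (0 : ℝ)..2 * Real.pi,
      f (σ t) * (starRingEnd ℂ) (contourKernel σ ρ t (lam i)) =
      (starRingEnd ℂ) (∫ t in (0 : ℝ)..2 * Real.pi,
        (starRingEnd ℂ) (f (σ t)) * contourKernel σ ρ t (lam i)) := fun i => by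
    rw [← intervalIntegral.intervalIntegral_conj]
    simp only [map_mul, Complex.conj_conj]
  simp only [e1, e2] at key
  rwa [hstar]

end IsSpectralResolution

/-- If `‖T + Gᴴ‖ ≤ 2`, then `‖T‖⁴ ≤ 2 ‖T‖³ + ‖T‖ ‖T G T‖`. -/
theorem norm_pow_four_le {A : Type*} [CStarAlgebra A] {T G : A} (h : ‖T + star G‖ ≤ 2) :
    ‖T‖ ^ 4 ≤ 2 * ‖T‖ ^ 3 + ‖T‖ * ‖T * G * T‖ := by
  -- The middle `star T` is replaced by `star (T + star G) - G`; by the C*-identity the left side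
  -- has norm `‖T‖ ^ 4`.
  have h1 : star T * T * (star T * T) =
      star T * T * star (T + star G) * T - star T * (T * G * T) := by
    rw [star_add, star_star]; noncomm_ring
  have h2 : ‖star T * T * (star T * T)‖ = ‖T‖ ^ 4 := by
    have : star T * T * (star T * T) = star (star T * T) * (star T * T) := by simp
    rw [this, CStarRing.norm_star_mul_self, CStarRing.norm_star_mul_self]; ring
  rw [← h2, h1]
  refine (norm_sub_le _ _).trans ?_
  gcongr
  · calc ‖star T * T * star (T + star G) * T‖ ≤ ‖T‖ * ‖T‖ * ‖T + star G‖ * ‖T‖ := by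
          refine (norm_mul_le _ _).trans ?_
          gcongr
          refine (norm_mul_le _ _).trans ?_
          rw [norm_star]
          gcongr
          refine (norm_mul_le _ _).trans ?_
          rw [norm_star]
      _ ≤ ‖T‖ * ‖T‖ * 2 * ‖T‖ := by gcongr
      _ = 2 * ‖T‖ ^ 3 := by ring
  · exact (norm_mul_le _ _).trans (by rw [norm_star])

variable {ι : Type*} [Fintype ι] [DecidableEq ι] {B : H →L[ℂ] H} {lam : ι → ℂ}
  {P : ι → H →L[ℂ] H}

/-- The numerical range is a `3`-spectral set, for diagonalizable operators. -/
theorem IsSpectralResolution.norm_le_three (D : IsSpectralResolution B lam P) {C : Set ℂ}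
    (hC : IsCompact C) (hconv : Convex ℝ C) (hne : C.Nonempty) (hlam : ∀ i, lam i ∈ C)
    (hB : ∀ x, ‖x‖ = 1 → ⟪x, B x⟫_ℂ ∈ C) {δ : ℝ} (hδ : 0 < δ) {f : ℂ → ℂ}
    (hf : DifferentiableOn ℂ f (Metric.thickening δ C))
    (hf1 : ∀ z ∈ Metric.thickening δ C, ‖f z‖ ≤ 1) : ‖∑ i, f (lam i) • P i‖ ≤ 3 := by
  -- The supremum runs over all neighbourhoods at once, since `f g f / 3` is only available on a
  -- smaller one than `f`.
  set F : Set ℝ := {x | ∃ δ > 0, ∃ f : ℂ → ℂ, DifferentiableOn ℂ f (Metric.thickening δ C) ∧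
    (∀ z ∈ Metric.thickening δ C, ‖f z‖ ≤ 1) ∧ x = ‖∑ i, f (lam i) • P i‖} with hF
  have hbdd : BddAbove F := by
    refine ⟨∑ i, ‖P i‖, ?_⟩
    rintro x ⟨δ, hδ, f, -, hf1, rfl⟩
    refine (norm_sum_le _ _).trans (Finset.sum_le_sum fun i _ => ?_)
    rw [norm_smul]
    exact mul_le_of_le_one_left (norm_nonneg _)
      (hf1 _ (Metric.self_subset_thickening hδ C (hlam i)))
  have hmemF : ‖∑ i, f (lam i) • P i‖ ∈ F := ⟨δ, hδ, f, hf, hf1, rfl⟩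
  have hstep : ∀ x ∈ F, x ^ 4 ≤ 2 * x ^ 3 + x * (3 * sSup F) := by
    rintro x ⟨δ, hδ, f, hf, hf1, rfl⟩
    obtain ⟨η, hη, σ, ρ, K⟩ := exists_isConvexContour hC hconv hne hδ
    set g : ℂ → ℂ := fun z => ∫ t in (0 : ℝ)..2 * Real.pi,
      (starRingEnd ℂ) (f (σ t)) * contourKernel σ ρ t z with hg
    have hU : IsOpen (Metric.thickening δ C) := Metric.isOpen_thickening
    have hUc := hconv.thickening δ
    have h2 := D.norm_add_star_le_two K hη hU hUc (Metric.self_subset_thickening hδ C) hlam hB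
      hf hf1
    refine (norm_pow_four_le h2).trans ?_
    gcongr
    rw [D.sum_smul_mul_sum_smul, D.sum_smul_mul_sum_smul]
    have hfc : Continuous fun t => (starRingEnd ℂ) (f (σ t)) :=
      Complex.continuous_conj.comp (hf.continuousOn.comp_continuous K.continuous K.mem)
    have hsub1 : Metric.thickening (min δ η) C ⊆ Metric.thickening δ C :=
      Metric.thickening_mono (min_le_left _ _) C
    have hsub2 : Metric.thickening (min δ η) C ⊆ Metric.thickening η C :=
      Metric.thickening_mono (min_le_right _ _) C
    have hgd := (K.differentiableOn_integral_mul_kernel hfc).mono hsub2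
    have hfd := hf.mono hsub1
    have hq : ‖∑ i, (f (lam i) * g (lam i) * f (lam i) / 3) • P i‖ ∈ F := by
      refine ⟨min δ η, lt_min hδ hη, fun z => f z * g z * f z / 3,
        ((hfd.mul hgd).mul hfd).div_const 3, ?_, rfl⟩
      intro z hz
      have h3 := K.norm_integral_conj_mul_kernel_le hU hUc hf hf1 (hsub1 hz) (hsub2 hz)
      have h4 := hf1 z (hsub1 hz)
      rw [norm_div, norm_mul, norm_mul]
      have h5 : ‖f z‖ * ‖g z‖ * ‖f z‖ ≤ 1 * 3 * 1 := by gcongr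
      have : ‖(3 : ℂ)‖ = 3 := by simp
      rw [this]
      linarith
    have h6 := le_csSup hbdd hq
    have h7 : (∑ i, (f (lam i) * g (lam i) * f (lam i)) • P i) =
        (3 : ℂ) • ∑ i, (f (lam i) * g (lam i) * f (lam i) / 3) • P i := by
      rw [Finset.smul_sum]
      refine Finset.sum_congr rfl fun i _ => ?_
      rw [smul_smul]
      congr 1
      ring
    rw [h7, norm_smul]
    have : ‖(3 : ℂ)‖ = 3 := by simp
    rw [this]
    gcongr
  refine (le_csSup hbdd hmemF).trans ?_
  -- If `K = sSup F > 3`, take `x ∈ F` beyond the midpoint of 3 and `K`. Then `hstep` gives `x (x +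
  -- 1) (x - 3) ≤ 3 (K - x) < 3 (x - 3)`, whereas the left side is at least `12 (x - 3)`.
  by_contra! hK
  obtain ⟨x, hx, hxK⟩ := exists_lt_of_lt_csSup ⟨_, hmemF⟩
    (show (sSup F + 3) / 2 < sSup F by linarith)
  have h1 := hstep x hx
  have hx3 : 3 < x := by linarith
  have h2 : x * (x ^ 3 - 2 * x ^ 2 - 3 * sSup F) ≤ 0 := by nlinarith
  have h3 : x ^ 3 - 2 * x ^ 2 - 3 * sSup F ≤ 0 := nonpos_of_mul_nonpos_right h2 (by linarith)
  have h4 : x ^ 3 - 2 * x ^ 2 - 3 * x = x * (x + 1) * (x - 3) := by ring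
  have h5 : 12 * (x - 3) ≤ x * (x + 1) * (x - 3) := by
    gcongr
    nlinarith
  nlinarith

end

end

/-! ### Polynomial functional calculus: simple spectrum, then all matrices by perturbation. -/

noncomputable section

open Polynomial

theorem aeval_eq_of_eval_eq {A : Type*} [Ring A] [Algebra ℂ A] {a : A} {s : Finset ℂ}
    (ha : aeval a (∏ z ∈ s, (X - C z)) = 0) {p q : ℂ[X]} (hpq : ∀ z ∈ s, p.eval z = q.eval z) :
    aeval a p = aeval a q := by
  have hdvd : ∏ z ∈ s, (X - C z) ∣ p - q := by
    apply Finset.prod_dvd_of_coprime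
    · exact fun x _ y _ hxy => isCoprime_X_sub_C_of_isUnit_sub (sub_ne_zero.2 hxy).isUnit
    · intro z hz
      rw [dvd_iff_isRoot, IsRoot, eval_sub, hpq z hz, sub_self]
  obtain ⟨r, hr⟩ := hdvd
  rw [← sub_eq_zero, ← map_sub, hr, map_mul, ha, zero_mul]

theorem eval_lagrange_basis (s : Finset ℂ) (i : s) {z : ℂ} (hz : z ∈ s) :
    (Lagrange.basis s id (i : ℂ)).eval z = if (i : ℂ) = z then 1 else 0 := by
  split_ifs with h
  · subst h
    exact Lagrange.eval_basis_self (v := id) (Set.injOn_id _) i.2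
  · exact Lagrange.eval_basis_of_ne (v := id) h hz

theorem aeval_eq_sum_lagrange_basis {A : Type*} [Ring A] [Algebra ℂ A] {a : A} {s : Finset ℂ}
    (ha : aeval a (∏ z ∈ s, (X - C z)) = 0) (p : ℂ[X]) :
    aeval a p = ∑ i : s, p.eval (i : ℂ) • aeval a (Lagrange.basis s id (i : ℂ)) := by
  have : aeval a p = aeval a (∑ i : s, C (p.eval (i : ℂ)) * Lagrange.basis s id (i : ℂ)) := by
    apply aeval_eq_of_eval_eq ha
    intro z hz
    rw [eval_finsetSum, Finset.sum_eq_single ⟨z, hz⟩]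
    · rw [eval_mul, eval_lagrange_basis s _ hz, if_pos rfl, eval_C, mul_one]
    · intro i _ hi
      rw [eval_mul, eval_lagrange_basis s _ hz, if_neg, mul_zero]
      exact fun h => hi (Subtype.ext h)
    · simp
  rw [this, map_sum]
  simp [Algebra.smul_def]

theorem isSpectralResolution_lagrange {H : Type*} [NormedAddCommGroup H] [InnerProductSpace ℂ H]
    [CompleteSpace H] {T : H →L[ℂ] H} {s : Finset ℂ}
    (hT : aeval T (∏ z ∈ s, (X - C z)) = 0) :
    IsSpectralResolution T (fun i : s => (i : ℂ))
      (fun i : s => aeval T (Lagrange.basis s id (i : ℂ))) where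
  mul_eq i j := by
    rw [← map_mul]
    split_ifs with h
    · subst h
      apply aeval_eq_of_eval_eq hT
      intro z hz
      rw [eval_mul, eval_lagrange_basis s _ hz]
      split_ifs <;> simp
    · rw [← map_zero (aeval (R := ℂ) T)]
      apply aeval_eq_of_eval_eq hT
      intro z hz
      rw [eval_mul, eval_lagrange_basis s _ hz, eval_lagrange_basis s _ hz]
      split_ifs with h1 h2
      · exact absurd (Subtype.ext (h1.trans h2.symm)) h
      all_goals simp
  sum_eq := by
    have := aeval_eq_sum_lagrange_basis hT 1
    simpa using this.symm
  eq_sum := by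
    have := aeval_eq_sum_lagrange_basis hT X
    simpa using this

variable {ι : Type*} [Fintype ι] [DecidableEq ι]

theorem nodup_roots_iff_prod_eval_derivative_ne_zero {f : ℂ[X]} :
    f.roots.Nodup ↔ (f.roots.map fun x => eval x (derivative f)).prod ≠ 0 := by
  by_cases hf : f = 0
  · simp [hf]
  rw [Ne, Multiset.prod_eq_zero_iff, Multiset.nodup_iff_count_le_one]
  simp only [Multiset.mem_map, not_exists, not_and, mem_roots hf, count_roots]
  constructor
  · intro h x hx h0
    exact absurd ((one_lt_rootMultiplicity_iff_isRoot hf).2 ⟨hx, h0⟩) (not_lt.2 (h x))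
  · intro h x
    by_contra! hx
    obtain ⟨h1, h2⟩ := (one_lt_rootMultiplicity_iff_isRoot hf).1 hx
    exact h x h1 h2

/-- On the line through `B` and `D`, where `D` has simple eigenvalues, all but finitely many
matrices have simple eigenvalues. -/
theorem Matrix.finite_not_nodup_roots_charpoly (B D : Matrix ι ι ℂ) (hD : D.charpoly.roots.Nodup) :
    {t : ℂ | ¬ (B + t • (D - B)).charpoly.roots.Nodup}.Finite := by
  set M : Matrix ι ι ℂ[X] := B.map C + (X : ℂ[X]) • (D - B).map C with hM
  -- The discriminant of the characteristic polynomial as a polynomial in the line parameter. Fixing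
  -- the two formal degrees makes it commute with evaluation; it is nonzero because its value at 1
  -- belongs to `D`.
  set r : ℂ[X] := resultant M.charpoly (derivative M.charpoly) (Fintype.card ι)
    (Fintype.card ι - 1) with hr
  have heval : ∀ t : ℂ, M.map (evalRingHom t) = B + t • (D - B) := by
    intro t
    ext i j
    simp [hM, Matrix.map_apply, Matrix.add_apply, Matrix.smul_apply]
  have hrt : ∀ t : ℂ, r.eval t ≠ 0 ↔ (B + t • (D - B)).charpoly.roots.Nodup := by
    intro t
    have h1 : r.eval t = resultant (B + t • (D - B)).charpoly
        (derivative (B + t • (D - B)).charpoly) (Fintype.card ι) (Fintype.card ι - 1) := by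
      rw [← heval t, Matrix.charpoly_map, derivative_map, resultant_map_map]
      rfl
    set f := (B + t • (D - B)).charpoly with hf
    have hdeg : f.natDegree = Fintype.card ι := Matrix.charpoly_natDegree_eq_dim _
    have hmon : f.Monic := Matrix.charpoly_monic _
    have h2 := resultant_eq_prod_eval f (derivative f) (Fintype.card ι - 1)
      (by rw [← hdeg]; exact natDegree_derivative_le f) (IsAlgClosed.splits f)
    rw [hdeg, hmon.leadingCoeff, one_pow, one_mul] at h2
    rw [h1, h2, nodup_roots_iff_prod_eval_derivative_ne_zero]
  have hr0 : r ≠ 0 := by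
    intro h0
    have := (hrt 1).2 (by simpa using hD)
    rw [h0] at this
    simp at this
  refine (r.roots.toFinset.finite_toSet).subset fun t ht => ?_
  have : r.eval t = 0 := by
    by_contra h
    exact ht ((hrt t).1 h)
  simp [hr0, this]

theorem Matrix.exists_nodup_roots_charpoly (ι : Type*) [Fintype ι] [DecidableEq ι] :
    ∃ D : Matrix ι ι ℂ, D.charpoly.roots.Nodup := by
  refine ⟨Matrix.diagonal fun i => (((Fintype.equivFin ι i : ℕ) : ℂ)), ?_⟩
  rw [Matrix.charpoly_diagonal]
  apply nodup_roots
  rw [separable_prod_X_sub_C_iff]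
  intro i j hij
  have : (Fintype.equivFin ι i : ℕ) = Fintype.equivFin ι j := Nat.cast_injective (R := ℂ) hij
  exact (Fintype.equivFin ι).injective (Fin.ext this)

open scoped InnerProductSpace

theorem ContinuousLinearMap.eigenvalue_mem_of_inner_mem
    {T : EuclideanSpace ℂ ι →L[ℂ] EuclideanSpace ℂ ι} {S : Set ℂ}
    (hT : ∀ x, ‖x‖ = 1 → ⟪x, T x⟫_ℂ ∈ S) {z : ℂ} (hz : z ∈ spectrum ℂ T) : z ∈ S := by
  have hz' : z ∈ spectrum ℂ (T : EuclideanSpace ℂ ι →ₗ[ℂ] EuclideanSpace ℂ ι) := by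
    rwa [← AlgEquiv.spectrum_eq (Module.End.toContinuousLinearMap (𝕜 := ℂ)
      (EuclideanSpace ℂ ι)).symm T] at hz
  rw [← Module.End.hasEigenvalue_iff_mem_spectrum] at hz'
  obtain ⟨v, hv⟩ := hz'.exists_hasEigenvector
  have hv1 : T v = z • v := hv.apply_eq_smul
  have hpos : 0 < ‖v‖ := norm_pos_iff.2 hv.2
  have h1 := hT (((‖v‖⁻¹ : ℝ) : ℂ) • v) (by
    rw [norm_smul, Complex.norm_real, norm_inv, norm_norm, inv_mul_cancel₀ hpos.ne'])
  rw [map_smul, inner_smul_left, inner_smul_right, hv1, inner_smul_right,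
    inner_self_eq_norm_sq_to_K] at h1
  convert h1 using 1
  have : (‖v‖ : ℂ) ≠ 0 := by exact_mod_cast hpos.ne'
  simp
  field_simp

/-- Simple roots make the Lagrange basis at `B` a spectral resolution, and `p(B) = F q(B)` with `F`
the value of `p / q` at `B`. A conclusion without `q(B)⁻¹` passes directly to limits in `B`. -/
theorem norm_aeval_apply_le_of_nodup {B : Matrix ι ι ℂ} (hB : B.charpoly.roots.Nodup)
    {S : Set ℂ} (hS : IsCompact S) (hconv : Convex ℝ S) (hne : S.Nonempty)
    (hW : ∀ x, ‖x‖ = 1 → ⟪x, Matrix.toEuclideanCLM (𝕜 := ℂ) B x⟫_ℂ ∈ S) {δ : ℝ} (hδ : 0 < δ)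
    {p q : ℂ[X]} {c : ℝ} (hc : 0 < c) (hq : ∀ z ∈ Metric.thickening δ S, q.eval z ≠ 0)
    (hpq : ∀ z ∈ Metric.thickening δ S, ‖p.eval z‖ ≤ c * ‖q.eval z‖)
    (y : EuclideanSpace ℂ ι) :
    ‖aeval (Matrix.toEuclideanCLM (𝕜 := ℂ) B) p y‖ ≤
      3 * c * ‖aeval (Matrix.toEuclideanCLM (𝕜 := ℂ) B) q y‖ := by
  set T := Matrix.toEuclideanCLM (𝕜 := ℂ) B with hTdef
  set s : Finset ℂ := ⟨B.charpoly.roots, hB⟩ with hs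
  have hprod : ∏ z ∈ s, (X - C z) = B.charpoly := by
    have := (IsAlgClosed.splits B.charpoly).eq_prod_roots
    rw [(Matrix.charpoly_monic B).leadingCoeff, C_1, one_mul] at this
    exact this.symm
  have hT : aeval T (∏ z ∈ s, (X - C z)) = 0 := by
    rw [hprod, hTdef, aeval_algHom_apply (Matrix.toEuclideanCLM (𝕜 := ℂ) (n := ι)) B,
      Matrix.aeval_self_charpoly, map_zero]
  have D := isSpectralResolution_lagrange hT
  have hlam : ∀ i : s, (i : ℂ) ∈ S := by
    intro i
    apply T.eigenvalue_mem_of_inner_mem hW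
    rw [hTdef, AlgEquiv.spectrum_eq (Matrix.toEuclideanCLM (𝕜 := ℂ) (n := ι)),
      Matrix.mem_spectrum_iff_isRoot_charpoly]
    have : (i : ℂ) ∈ B.charpoly.roots := i.2
    exact (mem_roots (Matrix.charpoly_monic B).ne_zero).1 this
  have hmem : ∀ i : s, (i : ℂ) ∈ Metric.thickening δ S := fun i =>
    Metric.self_subset_thickening hδ S (hlam i)
  set F := ∑ i : s, (p.eval (i : ℂ) / q.eval (i : ℂ)) • aeval T (Lagrange.basis s id (i : ℂ))
    with hF
  have hFq : aeval T p = F * aeval T q := by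
    rw [aeval_eq_sum_lagrange_basis hT p, aeval_eq_sum_lagrange_basis hT q, hF,
      D.sum_smul_mul_sum_smul]
    refine Finset.sum_congr rfl fun i _ => ?_
    rw [div_mul_cancel₀ _ (hq _ (hmem i))]
  have hbound : ‖F‖ ≤ 3 * c := by
    have h1 := D.norm_le_three hS hconv hne hlam hW hδ
      (f := fun z => (c : ℂ)⁻¹ * (p.eval z / q.eval z))
      (((p.differentiable.differentiableOn).div (q.differentiable.differentiableOn) hq).const_mul _)
      (fun z hz => by
        rw [norm_mul, norm_div, norm_inv, Complex.norm_real, Real.norm_of_nonneg hc.le,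
          inv_mul_le_iff₀ hc, mul_one, div_le_iff₀ (norm_pos_iff.2 (hq z hz))]
        exact hpq z hz)
    have h2 : F = (c : ℂ) • ∑ i : s, ((c : ℂ)⁻¹ * (p.eval (i : ℂ) / q.eval (i : ℂ))) •
        aeval T (Lagrange.basis s id (i : ℂ)) := by
      have : (c : ℂ) ≠ 0 := by exact_mod_cast hc.ne'
      rw [Finset.smul_sum]
      refine Finset.sum_congr rfl fun i _ => ?_
      rw [smul_smul, mul_inv_cancel_left₀ this]
    rw [h2, norm_smul, Complex.norm_real, Real.norm_of_nonneg hc.le]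
    nlinarith
  rw [hFq]
  exact (F.le_opNorm _).trans (mul_le_mul_of_nonneg_right hbound (norm_nonneg _))

/-- The numerical range is a `3`-spectral set: if `|p| ≤ c |q|` and `q ≠ 0` on a compact convex
set containing it, then `‖p(B) y‖ ≤ 3 c ‖q(B) y‖`. -/
theorem norm_aeval_apply_le [Nonempty ι] (B : Matrix ι ι ℂ) {S : Set ℂ} (hS : IsCompact S)
    (hconv : Convex ℝ S) (hW : ∀ x, ‖x‖ = 1 → ⟪x, Matrix.toEuclideanCLM (𝕜 := ℂ) B x⟫_ℂ ∈ S)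
    {p q : ℂ[X]} {c : ℝ} (hc : 0 ≤ c) (hq : ∀ z ∈ S, q.eval z ≠ 0)
    (hpq : ∀ z ∈ S, ‖p.eval z‖ ≤ c * ‖q.eval z‖) (y : EuclideanSpace ℂ ι) :
    ‖aeval (Matrix.toEuclideanCLM (𝕜 := ℂ) B) p y‖ ≤
      3 * c * ‖aeval (Matrix.toEuclideanCLM (𝕜 := ℂ) B) q y‖ := by
  have hne : S.Nonempty := by
    obtain ⟨x, hx⟩ := exists_norm_eq (EuclideanSpace ℂ ι) zero_le_one
    exact ⟨_, hW x hx⟩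
  -- The slack `ε` makes the inequality strict, so that it persists on an open neighbourhood of `S`.
  suffices h : ∀ ε > 0, ‖aeval (Matrix.toEuclideanCLM (𝕜 := ℂ) B) p y‖ ≤
      3 * (c + ε) * ‖aeval (Matrix.toEuclideanCLM (𝕜 := ℂ) B) q y‖ by
    have hlim : Filter.Tendsto (fun ε : ℝ => 3 * (c + ε) *
        ‖aeval (Matrix.toEuclideanCLM (𝕜 := ℂ) B) q y‖) (nhdsWithin 0 (Set.Ioi 0))
        (nhds (3 * (c + 0) * ‖aeval (Matrix.toEuclideanCLM (𝕜 := ℂ) B) q y‖)) :=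
      (Continuous.tendsto (by fun_prop) 0).mono_left nhdsWithin_le_nhds
    rw [add_zero] at hlim
    exact ge_of_tendsto hlim (eventually_nhdsWithin_of_forall h)
  intro ε hε
  have hopen : IsOpen ({z : ℂ | q.eval z ≠ 0} ∩ {z | ‖p.eval z‖ < (c + ε) * ‖q.eval z‖}) :=
    (isOpen_ne_fun q.continuous continuous_const).inter
      (isOpen_lt p.continuous.norm (continuous_const.mul q.continuous.norm))
  obtain ⟨δ, hδ, hsub⟩ := hS.exists_thickening_subset_open hopen (fun z hz => by
    refine ⟨hq z hz, (hpq z hz).trans_lt ?_⟩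
    have := norm_pos_iff.2 (hq z hz)
    show c * ‖q.eval z‖ < (c + ε) * ‖q.eval z‖
    nlinarith)
  -- One half of `δ` absorbs the change of the numerical range under perturbation, the other is the
  -- neighbourhood on which `p / q` must be holomorphic.
  have hsub' : Metric.thickening (δ / 2) (Metric.cthickening (δ / 2) S) ⊆
      {z : ℂ | q.eval z ≠ 0} ∩ {z | ‖p.eval z‖ < (c + ε) * ‖q.eval z‖} := by
    refine (Metric.thickening_cthickening_subset _ (by positivity) S).trans ?_
    rwa [add_halves]
  obtain ⟨D, hD⟩ := Matrix.exists_nodup_roots_charpoly ι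
  have hBt : Continuous fun t : ℂ => Matrix.toEuclideanCLM (𝕜 := ℂ) (B + t • (D - B)) := by
    simp only [map_add, map_smul]
    fun_prop
  have hev1 : ∀ᶠ t in nhdsWithin (0 : ℂ) {0}ᶜ, (B + t • (D - B)).charpoly.roots.Nodup := by
    have hfin := Matrix.finite_not_nodup_roots_charpoly B D hD
    have h1 : ({t : ℂ | ¬ (B + t • (D - B)).charpoly.roots.Nodup} \ {0})ᶜ ∈ nhds (0 : ℂ) :=
      (hfin.subset Set.sdiff_subset).isClosed.isOpen_compl.mem_nhds (by simp)
    filter_upwards [mem_nhdsWithin_of_mem_nhds h1, self_mem_nhdsWithin] with t ht ht0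
    by_contra h
    exact ht ⟨h, ht0⟩
  have hev2 : ∀ᶠ t in nhdsWithin (0 : ℂ) {0}ᶜ,
      ‖Matrix.toEuclideanCLM (𝕜 := ℂ) (B + t • (D - B)) -
        Matrix.toEuclideanCLM (𝕜 := ℂ) B‖ < δ / 2 := by
    have h1 : Continuous fun t : ℂ => ‖Matrix.toEuclideanCLM (𝕜 := ℂ) (B + t • (D - B)) -
        Matrix.toEuclideanCLM (𝕜 := ℂ) B‖ := (hBt.sub continuous_const).norm
    have h2 := (h1.tendsto 0).mono_left (nhdsWithin_le_nhds (s := {0}ᶜ))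
    apply h2.eventually_lt_const
    simpa using hδ
  have hlim : ∀ r : ℂ[X], Filter.Tendsto (fun t : ℂ =>
      ‖aeval (Matrix.toEuclideanCLM (𝕜 := ℂ) (B + t • (D - B))) r y‖) (nhdsWithin (0 : ℂ) {0}ᶜ)
      (nhds ‖aeval (Matrix.toEuclideanCLM (𝕜 := ℂ) B) r y‖) := by
    intro r
    have h1 : Continuous fun t : ℂ =>
        ‖aeval (Matrix.toEuclideanCLM (𝕜 := ℂ) (B + t • (D - B))) r y‖ :=
      (((Polynomial.continuous_aeval r).comp hBt).clm_apply continuous_const).norm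
    have h2 := (h1.tendsto 0).mono_left (nhdsWithin_le_nhds (s := {0}ᶜ))
    simpa using h2
  refine le_of_tendsto_of_tendsto (hlim p) ((hlim q).const_mul (3 * (c + ε))) ?_
  filter_upwards [hev1, hev2] with t ht1 ht2
  refine norm_aeval_apply_le_of_nodup ht1 (hS.cthickening (r := δ / 2)) (hconv.cthickening _)
    (hne.mono (Metric.self_subset_cthickening S)) ?_ (half_pos hδ) (by positivity)
    (fun z hz => (hsub' hz).1) (fun z hz => (hsub' hz).2.le) y
  intro x hx
  refine Metric.mem_cthickening_of_dist_le _ _ _ _ (hW x hx) ?_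
  rw [dist_eq_norm, ← inner_sub_right, ← sub_apply]
  refine (norm_inner_le_norm _ _).trans ?_
  rw [hx, one_mul]
  refine (ContinuousLinearMap.le_opNorm _ _).trans ?_
  rw [hx, mul_one]
  exact ht2.le

end

/-! ### Singular values of solutions of Sylvester equations with low-rank right-hand side. -/

noncomputable section

open Polynomial

variable {ι κ : Type*} [Fintype κ]

/-- The entrywise real part of a complex vector. -/
def EuclideanSpace.rePart (w : EuclideanSpace ℂ κ) : EuclideanSpace ℝ κ :=
  WithLp.toLp 2 fun j => (w j).re

/-- The entrywise imaginary part of a complex vector. -/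
def EuclideanSpace.imPart (w : EuclideanSpace ℂ κ) : EuclideanSpace ℝ κ :=
  WithLp.toLp 2 fun j => (w j).im

open EuclideanSpace

theorem EuclideanSpace.norm_sq_rePart_add (w : EuclideanSpace ℂ κ) :
    ‖w‖ ^ 2 = ‖rePart w‖ ^ 2 + ‖imPart w‖ ^ 2 := by
  simp only [EuclideanSpace.norm_sq_eq, ← Finset.sum_add_distrib, rePart, imPart]
  refine Finset.sum_congr rfl fun i _ => ?_
  rw [← Complex.normSq_eq_norm_sq, Complex.normSq_apply, Real.norm_eq_abs, Real.norm_eq_abs,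
    sq_abs, sq_abs]
  ring

variable [DecidableEq κ]

theorem Matrix.rePart_toEuclideanLin_map (M : Matrix ι κ ℝ) (w : EuclideanSpace ℂ κ) :
    rePart (Matrix.toEuclideanLin (M.map Complex.ofReal) w) =
      Matrix.toEuclideanLin M (rePart w) := by
  ext i
  simp [rePart, Matrix.toLpLin_apply, Matrix.mulVec, dotProduct]

theorem Matrix.imPart_toEuclideanLin_map (M : Matrix ι κ ℝ) (w : EuclideanSpace ℂ κ) :
    imPart (Matrix.toEuclideanLin (M.map Complex.ofReal) w) =
      Matrix.toEuclideanLin M (imPart w) := by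
  ext i
  simp [imPart, Matrix.toLpLin_apply, Matrix.mulVec, dotProduct]

variable [Fintype ι]

theorem Matrix.norm_toEuclideanLin_le {𝕜 : Type*} [RCLike 𝕜] (M : Matrix ι κ 𝕜)
    (x : EuclideanSpace 𝕜 κ) : ‖Matrix.toEuclideanLin M x‖ ≤ ‖M‖ * ‖x‖ :=
  Matrix.l2_opNorm_mulVec M x

theorem Matrix.norm_toEuclideanLin_map_le (M : Matrix ι κ ℝ) (w : EuclideanSpace ℂ κ) :
    ‖Matrix.toEuclideanLin (M.map Complex.ofReal) w‖ ≤ ‖M‖ * ‖w‖ := by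
  apply le_of_sq_le_sq _ (by positivity)
  rw [norm_sq_rePart_add, M.rePart_toEuclideanLin_map, M.imPart_toEuclideanLin_map, mul_pow,
    norm_sq_rePart_add w, mul_add, ← mul_pow, ← mul_pow]
  gcongr <;> exact M.norm_toEuclideanLin_le _

/-- On the span of the eigenvectors of `TᴴT` for the `r + 1` largest singular values, `T` expands
by at least the smallest of these. -/
theorem LinearMap.sq_singularValues_mul_le {E F : Type*} [NormedAddCommGroup E]
    [InnerProductSpace ℝ E] [FiniteDimensional ℝ E] [NormedAddCommGroup F] [InnerProductSpace ℝ F]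
    [FiniteDimensional ℝ F] (T : E →ₗ[ℝ] F) {r : ℕ} (hr : r < Module.finrank ℝ E) :
    ∃ u : Fin (r + 1) → E, ∀ a : Fin (r + 1) → ℝ, ‖∑ i, a i • u i‖ ^ 2 = ∑ i, a i ^ 2 ∧
      T.singularValues r ^ 2 * ‖∑ i, a i • u i‖ ^ 2 ≤ ‖T (∑ i, a i • u i)‖ ^ 2 := by
  set hsym := T.isSymmetric_adjoint_comp_self
  set b := hsym.eigenvectorBasis rfl with hb
  set e : Fin (r + 1) → Fin (Module.finrank ℝ E) := fun i => ⟨i, by omega⟩ with he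
  have hinj : Function.Injective e := fun i j hij => by
    simpa [he, Fin.ext_iff] using hij
  have hon : Orthonormal ℝ fun i => b (e i) := b.orthonormal.comp e hinj
  refine ⟨fun i => b (e i), fun a => ?_⟩
  have hnorm : ‖∑ i, a i • b (e i)‖ ^ 2 = ∑ i, a i ^ 2 := by
    rw [← real_inner_self_eq_norm_sq, hon.inner_sum]
    simp [pow_two]
  refine ⟨hnorm, ?_⟩
  have hT : ‖T (∑ i, a i • b (e i))‖ ^ 2 = ∑ i, a i * (hsym.eigenvalues rfl (e i) * a i) := by
    rw [← real_inner_self_eq_norm_sq, ← LinearMap.adjoint_inner_right]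
    have : (LinearMap.adjoint T) (T (∑ i, a i • b (e i))) =
        ∑ i, (hsym.eigenvalues rfl (e i) * a i) • b (e i) := by
      rw [← LinearMap.comp_apply, map_sum]
      refine Finset.sum_congr rfl fun i _ => ?_
      rw [map_smul, hsym.apply_eigenvectorBasis, smul_smul, mul_comm]
      rfl
    rw [this, hon.inner_sum]
    simp
  rw [hT, hnorm, Finset.mul_sum]
  refine Finset.sum_le_sum fun i _ => ?_
  have h1 : T.singularValues r ^ 2 ≤ hsym.eigenvalues rfl (e i) := by
    rw [T.sq_singularValues_of_lt rfl hr]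
    exact hsym.eigenvalues_antitone rfl (by simp [he, Fin.le_def]; omega)
  nlinarith [sq_nonneg (a i)]

/-- A bound for a real matrix on a complex subspace of codimension at most `r` is a bound for its
`(r+1)`-st singular value. -/
theorem singularValue_le_of_ker {V : Type*} [AddCommGroup V] [Module ℂ V] [FiniteDimensional ℂ V]
    (M : Matrix ι κ ℝ) {r : ℕ} {c : ℝ} (hc : 0 ≤ c) (g : EuclideanSpace ℂ κ →ₗ[ℂ] V)
    (hV : Module.finrank ℂ V ≤ r)
    (hM : ∀ w, g w = 0 → ‖Matrix.toEuclideanLin (M.map Complex.ofReal) w‖ ≤ c * ‖w‖) :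
    singularValue M (r + 1) ≤ c := by
  rw [singularValue, Nat.add_sub_cancel]
  set T := Matrix.toEuclideanLin M with hTdef
  by_cases hr : r < Module.finrank ℝ (EuclideanSpace ℝ κ)
  swap
  · rw [T.singularValues_of_finrank_le (not_lt.1 hr)]; exact hc
  obtain ⟨u, hu⟩ := T.sq_singularValues_mul_le hr
  -- Complex combinations of the `r + 1` leading real right singular vectors. Their number exceeds
  -- the dimension of `V`, so some nonzero combination is killed by `g`; the lower bound for `T`
  -- applies to its real and imaginary parts separately.
  set Φ : (Fin (r + 1) → ℂ) →ₗ[ℂ] EuclideanSpace ℂ κ := Fintype.linearCombination ℂ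
    fun i => WithLp.toLp 2 fun j => ((u i j : ℝ) : ℂ) with hΦ
  have hre : ∀ a, rePart (Φ a) = ∑ i, (a i).re • u i := by
    intro a
    ext j
    simp [rePart, hΦ, Fintype.linearCombination_apply]
  have him : ∀ a, imPart (Φ a) = ∑ i, (a i).im • u i := by
    intro a
    ext j
    simp [imPart, hΦ, Fintype.linearCombination_apply]
  have hker : (g ∘ₗ Φ).ker ≠ ⊥ := by
    apply LinearMap.ker_ne_bot_of_finrank_lt
    rw [Module.finrank_fin_fun]
    omega
  obtain ⟨a, ha, ha0⟩ := Submodule.exists_mem_ne_zero_of_ne_bot hker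
  have hw := hM (Φ a) ha
  have hpos : 0 < ‖Φ a‖ ^ 2 := by
    rw [norm_sq_rePart_add, hre, him, (hu _).1, (hu _).1, ← Finset.sum_add_distrib]
    obtain ⟨i, hi⟩ := Function.ne_iff.1 ha0
    apply Finset.sum_pos' (fun _ _ => by positivity) ⟨i, Finset.mem_univ _, ?_⟩
    have := Complex.normSq_pos.2 hi
    rw [Complex.normSq_apply] at this
    nlinarith
  have hlow : T.singularValues r ^ 2 * ‖Φ a‖ ^ 2 ≤ c ^ 2 * ‖Φ a‖ ^ 2 := by
    calc T.singularValues r ^ 2 * ‖Φ a‖ ^ 2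
        ≤ ‖Matrix.toEuclideanLin (M.map Complex.ofReal) (Φ a)‖ ^ 2 := by
          rw [norm_sq_rePart_add (Φ a), norm_sq_rePart_add (Matrix.toEuclideanLin _ _),
            M.rePart_toEuclideanLin_map, M.imPart_toEuclideanLin_map, hre, him, mul_add]
          exact add_le_add (hu _).2 (hu _).2
      _ ≤ (c * ‖Φ a‖) ^ 2 := by gcongr
      _ = _ := by ring
  exact le_of_sq_le_sq (le_of_mul_le_mul_right hlow hpos) hc

theorem Matrix.exists_mul_eq_of_rank (M : Matrix ι κ ℝ) :
    ∃ (F : Matrix ι (Fin M.rank) ℝ) (G : Matrix (Fin M.rank) κ ℝ), M = F * G := by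
  set b := Module.finBasis ℝ (LinearMap.range M.mulVecLin)
  refine ⟨Matrix.of fun i j => (b j : ι → ℝ) i, Matrix.of fun j c =>
    b.repr ⟨M.mulVecLin (Pi.single c 1), LinearMap.mem_range_self _ _⟩ j, ?_⟩
  ext i c
  have h1 := b.sum_repr ⟨M.mulVecLin (Pi.single c 1), LinearMap.mem_range_self _ _⟩
  have h2 := congrFun (congrArg Subtype.val h1) i
  rw [Matrix.mul_apply]
  simp only [AddSubmonoidClass.coe_finsetSum, Finset.sum_apply, Submodule.coe_smul,
    Pi.smul_apply, smul_eq_mul, Matrix.mulVecLin_apply, Matrix.mulVec_single_one,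
    Matrix.col_apply] at h2
  rw [← h2]
  refine Finset.sum_congr rfl fun j _ => ?_
  show _ = (b j : ι → ℝ) i * b.repr ⟨M.mulVecLin (Pi.single c 1), _⟩ j
  simp [mul_comm]

variable [DecidableEq ι]

open scoped InnerProductSpace

theorem ContinuousLinearMap.aeval_coe_apply {E : Type*} [NormedAddCommGroup E] [NormedSpace ℂ E]
    (A : E →L[ℂ] E) (r : ℂ[X]) (x : E) : aeval (A : E →ₗ[ℂ] E) r x = aeval A r x := by
  rw [aeval_eq_sum_range, aeval_eq_sum_range]
  simp only [LinearMap.sum_apply, sum_apply, LinearMap.smul_apply, smul_apply,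
    ← ContinuousLinearMap.toLinearMap_pow, ContinuousLinearMap.coe_coe]

/-- Each condition `G (N^j v) = 0` moves `M` past one more factor, so `d` conditions reach the power
`d`, that is, polynomials of degree `d`. -/
theorem apply_aeval_eq_of_intertwine {V W U : Type*} [AddCommGroup V] [Module ℂ V]
    [AddCommGroup W] [Module ℂ W] [AddCommGroup U] [Module ℂ U] (L : W →ₗ[ℂ] W) (N : V →ₗ[ℂ] V)
    (M : V →ₗ[ℂ] W) (F : U →ₗ[ℂ] W) (G : V →ₗ[ℂ] U)
    (h : ∀ x, L (M x) - M (N x) = F (G x)) {d : ℕ} {v : V}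
    (hv : ∀ j < d, G ((N ^ j) v) = 0) {p : ℂ[X]} (hp : p.natDegree ≤ d) :
    M (aeval N p v) = aeval L p (M v) := by
  have hpow : ∀ j ≤ d, M ((N ^ j) v) = (L ^ j) (M v) := by
    intro j
    induction j with
    | zero => simp
    | succ j ih =>
      intro hj
      have h1 := h ((N ^ j) v)
      rw [hv j (by omega), map_zero, sub_eq_zero, ih (by omega)] at h1
      rw [pow_succ', pow_succ', Module.End.mul_apply, Module.End.mul_apply, h1]
  rw [aeval_eq_sum_range, aeval_eq_sum_range]
  simp only [LinearMap.sum_apply, map_sum, LinearMap.smul_apply, map_smul]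
  refine Finset.sum_congr rfl fun j hj => ?_
  rw [hpow j (by rw [Finset.mem_range] at hj; omega)]

/-- If `L M - M N` has low rank, and the numerical ranges of `L` and `N` are separated by a rational
function `p / q`, then the singular values of `M` decay. -/
theorem singularValue_le_of_sylvester [Nonempty ι] [Nonempty κ] {τ : Type*} [Fintype τ]
    (L : Matrix ι ι ℝ) (N : Matrix κ κ ℝ) (M : Matrix ι κ ℝ) (F : Matrix ι τ ℝ) (G : Matrix τ κ ℝ)
    (hs : L * M - M * N = F * G) {S₁ S₂ : Set ℂ} (hS₁ : IsCompact S₁) (hS₁c : Convex ℝ S₁)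
    (hS₂ : IsCompact S₂) (hS₂c : Convex ℝ S₂)
    (hL : ∀ x, ‖x‖ = 1 →
      ⟪x, Matrix.toEuclideanCLM (𝕜 := ℂ) (L.map Complex.ofReal) x⟫_ℂ ∈ S₁)
    (hN : ∀ x, ‖x‖ = 1 →
      ⟪x, Matrix.toEuclideanCLM (𝕜 := ℂ) (N.map Complex.ofReal) x⟫_ℂ ∈ S₂)
    {p q : ℂ[X]} {d : ℕ} (hp : p.natDegree ≤ d) (hq : q.natDegree ≤ d)
    (hq0 : ∀ z ∈ S₁, q.eval z ≠ 0) (hp0 : ∀ z ∈ S₂, p.eval z ≠ 0) {a b : ℝ} (ha : 0 ≤ a)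
    (hb : 0 ≤ b) (hpq : ∀ z ∈ S₁, ‖p.eval z‖ ≤ a * ‖q.eval z‖)
    (hqp : ∀ z ∈ S₂, ‖q.eval z‖ ≤ b * ‖p.eval z‖) :
    singularValue M (d * Fintype.card τ + 1) ≤ 9 * a * b * ‖M‖ := by
  classical
  set Lc := Matrix.toEuclideanCLM (𝕜 := ℂ) (L.map Complex.ofReal) with hLc
  set Nc := Matrix.toEuclideanCLM (𝕜 := ℂ) (N.map Complex.ofReal) with hNc
  set Mc := Matrix.toEuclideanLin (M.map Complex.ofReal) with hMc
  -- The spectral set bound for `1 / p`, which is bounded on the compact set `S₂`.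
  have hinj : Function.Injective (aeval (Nc : EuclideanSpace ℂ κ →ₗ[ℂ] EuclideanSpace ℂ κ) p) := by
    rw [injective_iff_map_eq_zero]
    intro y hy
    rw [ContinuousLinearMap.aeval_coe_apply] at hy
    obtain ⟨c, hc⟩ := hS₂.exists_bound_of_continuousOn (f := fun z => (p.eval z)⁻¹)
      (ContinuousOn.inv₀ p.continuous.continuousOn hp0)
    have h1 := norm_aeval_apply_le (N.map Complex.ofReal) hS₂ hS₂c hN (p := 1) (q := p)
      (c := |c|) (abs_nonneg c) hp0 (fun z hz => by
        have h2 := hc z hz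
        have h3 := norm_pos_iff.2 (hp0 z hz)
        rw [norm_inv, inv_le_iff_one_le_mul₀ h3] at h2
        rw [eval_one, norm_one]
        refine h2.trans ?_
        gcongr
        exact le_abs_self c) y
    rw [← hNc, hy, norm_zero, mul_zero] at h1
    simpa using h1
  set e := LinearEquiv.ofInjectiveEndo _ hinj with he
  set Gc : EuclideanSpace ℂ κ →ₗ[ℂ] EuclideanSpace ℂ τ :=
    Matrix.toEuclideanLin (G.map Complex.ofReal) with hGc
  -- The conditions are imposed on `v = p(N)⁻¹ w` and pulled back to `w`; they amount to `d * card
  -- τ` scalar equations.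
  set g : EuclideanSpace ℂ κ →ₗ[ℂ] (Fin d → EuclideanSpace ℂ τ) :=
    LinearMap.pi fun j => Gc ∘ₗ ((Nc : EuclideanSpace ℂ κ →ₗ[ℂ] EuclideanSpace ℂ κ) ^ (j : ℕ)) ∘ₗ
      (e.symm : EuclideanSpace ℂ κ →ₗ[ℂ] EuclideanSpace ℂ κ) with hg
  have hsc : ∀ x, (Lc : EuclideanSpace ℂ ι →ₗ[ℂ] EuclideanSpace ℂ ι) (Mc x) -
      Mc ((Nc : EuclideanSpace ℂ κ →ₗ[ℂ] EuclideanSpace ℂ κ) x) =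
      Matrix.toEuclideanLin (F.map Complex.ofReal) (Gc x) := by
    intro x
    have hs' : L.map Complex.ofReal * M.map Complex.ofReal -
        M.map Complex.ofReal * N.map Complex.ofReal =
        F.map Complex.ofReal * G.map Complex.ofReal := by
      have := congrArg (fun A : Matrix ι κ ℝ => A.map Complex.ofRealHom) hs
      rw [Matrix.map_sub _ (map_sub _), Matrix.map_mul, Matrix.map_mul, Matrix.map_mul] at this
      exact this
    have h1 := congrArg (fun A : Matrix ι κ ℂ => A.mulVec x) hs'
    simp only [Matrix.sub_mulVec, ← Matrix.mulVec_mulVec] at h1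
    exact congrArg (WithLp.toLp 2) h1
  refine singularValue_le_of_ker M (by positivity) g ?_ ?_
  · rw [Module.finrank_pi_fintype]
    simp
  · intro w hw
    set v := e.symm w with hv
    have hev : aeval (Nc : EuclideanSpace ℂ κ →ₗ[ℂ] EuclideanSpace ℂ κ) p v = w :=
      e.apply_symm_apply w
    have hGv : ∀ j < d, Gc (((Nc : EuclideanSpace ℂ κ →ₗ[ℂ] EuclideanSpace ℂ κ) ^ j) v) = 0 :=
      fun j hj => congrFun hw ⟨j, hj⟩
    have h1 := apply_aeval_eq_of_intertwine _ _ Mc _ Gc hsc hGv hp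
    have h2 := apply_aeval_eq_of_intertwine _ _ Mc _ Gc hsc hGv hq
    rw [hev, ContinuousLinearMap.aeval_coe_apply] at h1
    rw [ContinuousLinearMap.aeval_coe_apply, ContinuousLinearMap.aeval_coe_apply] at h2
    rw [ContinuousLinearMap.aeval_coe_apply] at hev
    have h3 := norm_aeval_apply_le (L.map Complex.ofReal) hS₁ hS₁c hL ha hq0 hpq (Mc v)
    have h4 := norm_aeval_apply_le (N.map Complex.ofReal) hS₂ hS₂c hN hb hp0 hqp v
    rw [← hLc, ← h1, ← h2] at h3
    rw [← hNc, hev] at h4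
    -- `M w = p(L) M v` is compared with `q(L) M v = M q(N) v`, and then `q(N) v` with `p(N) v = w`.
    calc ‖Mc w‖ ≤ 3 * a * ‖Mc (aeval Nc q v)‖ := h3
      _ ≤ 3 * a * (‖M‖ * (3 * b * ‖w‖)) := by
          gcongr
          exact (M.norm_toEuclideanLin_map_le _).trans (by gcongr)
      _ = 9 * a * b * ‖M‖ * ‖w‖ := by ring

end

/-! ### Convexity of the numerical range. -/

noncomputable section

open scoped InnerProductSpace

section

variable {H : Type*} [NormedAddCommGroup H] [InnerProductSpace ℂ H]

/-- A phase `c` on `x` makes the sum of the cross terms real. The Rayleigh quotient is then real and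
continuous along the segment from `c • x` to `y`, which avoids 0, and the intermediate value theorem
applies. -/
theorem ContinuousLinearMap.exists_inner_eq_of_mem_Icc (S : H →L[ℂ] H) {x y : H} (hx : ‖x‖ = 1)
    (hx0 : ⟪x, S x⟫_ℂ = 0) (hy1 : ⟪y, S y⟫_ℂ = 1) (hy : ‖y‖ = 1) {s : ℝ} (hs : s ∈ Set.Icc (0 : ℝ) 1) :
    ∃ z, ‖z‖ = 1 ∧ ⟪z, S z⟫_ℂ = s := by
  set w := ⟪y, S x⟫_ℂ - (starRingEnd ℂ) ⟪x, S y⟫_ℂ with hw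
  obtain ⟨c, hc1, hc2⟩ : ∃ c : ℂ, (starRingEnd ℂ) c * c = 1 ∧ (c * w).im = 0 := by
    by_cases h0 : w = 0
    · exact ⟨1, by simp, by simp [h0]⟩
    · have hn : (‖w‖ : ℂ) ≠ 0 := by simpa using h0
      refine ⟨(starRingEnd ℂ) w / ‖w‖, ?_, ?_⟩
      · rw [map_div₀, Complex.conj_conj, Complex.conj_ofReal, div_mul_div_comm, Complex.mul_conj,
          Complex.normSq_eq_norm_sq]
        push_cast
        field_simp
      · rw [div_mul_eq_mul_div, mul_comm, Complex.mul_conj, ← Complex.ofReal_div,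
          Complex.ofReal_im]
  set κ := ((starRingEnd ℂ) c * ⟪x, S y⟫_ℂ + c * ⟪y, S x⟫_ℂ).re with hκ
  have hreal : (starRingEnd ℂ) c * ⟪x, S y⟫_ℂ + c * ⟪y, S x⟫_ℂ = κ := by
    apply Complex.ext
    · simp [hκ]
    · rw [hw, Complex.mul_im, Complex.sub_re, Complex.sub_im, Complex.conj_re,
        Complex.conj_im] at hc2
      rw [Complex.add_im, Complex.mul_im, Complex.mul_im, Complex.conj_re, Complex.conj_im,
        Complex.ofReal_im]
      linarith
  set z : ℝ → H := fun t => ((1 - t : ℝ) : ℂ) • c • x + (t : ℂ) • y with hz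
  have hq : ∀ t : ℝ, ⟪z t, S (z t)⟫_ℂ = ((t ^ 2 + t * (1 - t) * κ : ℝ) : ℂ) := by
    intro t
    have e : ⟪z t, S (z t)⟫_ℂ = ((1 - t : ℝ) : ℂ) ^ 2 * ((starRingEnd ℂ) c * c) * ⟪x, S x⟫_ℂ +
        (t : ℂ) ^ 2 * ⟪y, S y⟫_ℂ + (t : ℂ) * ((1 - t : ℝ) : ℂ) *
        ((starRingEnd ℂ) c * ⟪x, S y⟫_ℂ + c * ⟪y, S x⟫_ℂ) := by
      simp only [hz, map_add, map_smul, inner_add_left, inner_add_right, inner_smul_left,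
        inner_smul_right, Complex.conj_ofReal]
      ring
    rw [e, hx0, hy1, hreal]
    push_cast
    ring
  have hne : ∀ t, z t ≠ 0 := by
    intro t h0
    have h1 : (t : ℂ) • y = -(((1 - t : ℝ) : ℂ) • c • x) := by
      rw [eq_neg_iff_add_eq_zero, add_comm]; exact h0
    have h2 : ⟪(t : ℂ) • y, S ((t : ℂ) • y)⟫_ℂ = 0 := by
      rw [h1]
      simp [inner_smul_left, inner_smul_right, hx0]
    rw [map_smul, inner_smul_left, inner_smul_right, hy1] at h2
    have ht : t = 0 := by simpa using h2
    subst ht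
    have hc0 : c ≠ 0 := by
      rintro rfl
      simp at hc1
    have hx0' : x ≠ 0 := by
      rintro rfl
      simp at hx
    simp [hc0, hx0'] at h1
  have hzc : Continuous z := by
    simp only [hz]
    fun_prop
  have hpos : ∀ t, 0 < ‖z t‖ ^ 2 := fun t => by
    have := norm_pos_iff.2 (hne t)
    positivity
  have hcont : Continuous fun t : ℝ => (t ^ 2 + t * (1 - t) * κ) / ‖z t‖ ^ 2 := by
    apply Continuous.div₀ (by fun_prop) (by fun_prop)
    exact fun t => (hpos t).ne'
  have h0 : ((0 : ℝ) ^ 2 + 0 * (1 - 0) * κ) / ‖z 0‖ ^ 2 = 0 := by simp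
  have h1 : ((1 : ℝ) ^ 2 + 1 * (1 - 1) * κ) / ‖z 1‖ ^ 2 = 1 := by simp [hz, hy]
  obtain ⟨t, -, ht⟩ := intermediate_value_Icc zero_le_one hcont.continuousOn
    (by simpa only [h0, h1] using hs)
  have hn : 0 < ‖z t‖ := norm_pos_iff.2 (hne t)
  refine ⟨((‖z t‖⁻¹ : ℝ) : ℂ) • z t, ?_, ?_⟩
  · rw [norm_smul, Complex.norm_real, norm_inv, norm_norm, inv_mul_cancel₀ hn.ne']
  · rw [map_smul, inner_smul_left, inner_smul_right, hq, Complex.conj_ofReal, ← ht]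
    push_cast
    field_simp

/-- The Toeplitz-Hausdorff theorem. -/
theorem ContinuousLinearMap.convex_numericalRange (T : H →L[ℂ] H) :
    Convex ℝ {w : ℂ | ∃ x, ‖x‖ = 1 ∧ w = ⟪x, T x⟫_ℂ} := by
  rw [convex_iff_segment_subset]
  rintro _ ⟨x, hx, rfl⟩ _ ⟨y, hy, rfl⟩
  by_cases hab : ⟪x, T x⟫_ℂ = ⟪y, T y⟫_ℂ
  · rw [← hab, segment_same, Set.singleton_subset_iff]
    exact ⟨x, hx, rfl⟩
  set a := ⟪x, T x⟫_ℂ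
  set b := ⟪y, T y⟫_ℂ
  have hba : b - a ≠ 0 := sub_ne_zero.2 (Ne.symm hab)
  -- The affine change that sends the two given values to 0 and 1.
  set S : H →L[ℂ] H := (b - a)⁻¹ • (T - a • 1) with hS
  have hSq : ∀ z, ‖z‖ = 1 → ⟪z, S z⟫_ℂ = (b - a)⁻¹ * (⟪z, T z⟫_ℂ - a) := by
    intro z hz
    simp [hS, inner_self_eq_norm_sq_to_K, hz]
  rw [segment_eq_image']
  rintro _ ⟨s, hs, rfl⟩
  obtain ⟨z, hz, hzs⟩ := S.exists_inner_eq_of_mem_Icc hx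
    (by rw [hSq x hx]; simp [a]) (by rw [hSq y hy]; exact inv_mul_cancel₀ hba) hy hs
  refine ⟨z, hz, ?_⟩
  rw [hSq z hz] at hzs
  show a + (s : ℝ) • (b - a) = _
  rw [Complex.real_smul, ← hzs]
  field_simp
  ring

end
end

/-! ### The set `E`, compressions to submatrices, and the norm bound for the Riccati solution. -/

noncomputable section

open scoped InnerProductSpace

section numericalRange

variable {n : ℕ}

theorem numericalRange_eq (A : Matrix (Fin n) (Fin n) ℝ) : numericalRange A =
    {w | ∃ x, ‖x‖ = 1 ∧ w = ⟪x, Matrix.toEuclideanCLM (𝕜 := ℂ) (A.map Complex.ofReal) x⟫_ℂ} := by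
  ext w
  simp only [numericalRange, Set.mem_ofPred_eq, EuclideanSpace.inner_eq_star_dotProduct,
    Matrix.ofLp_toEuclideanCLM, dotProduct_comm]

theorem convex_numericalRange (A : Matrix (Fin n) (Fin n) ℝ) : Convex ℝ (numericalRange A) := by
  rw [numericalRange_eq]
  exact ContinuousLinearMap.convex_numericalRange _

theorem isCompact_numericalRange (A : Matrix (Fin n) (Fin n) ℝ) :
    IsCompact (numericalRange A) := by
  have : numericalRange A =
      (fun x => ⟪x, Matrix.toEuclideanCLM (𝕜 := ℂ) (A.map Complex.ofReal) x⟫_ℂ) ''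
        Metric.sphere 0 1 := by
    rw [numericalRange_eq]
    ext w
    simp [eq_comm]
  rw [this]
  exact (isCompact_sphere _ _).image (by fun_prop)

theorem numericalRange_transpose (A : Matrix (Fin n) (Fin n) ℝ) :
    numericalRange A.transpose ⊆ numericalRange A := by
  rintro _ ⟨x, hx, rfl⟩
  refine ⟨WithLp.toLp 2 (star x.ofLp), ?_, ?_⟩
  · rw [← hx, EuclideanSpace.norm_eq, EuclideanSpace.norm_eq]
    simp
  · rw [star_star, Matrix.transpose_map, Matrix.dotProduct_mulVec, Matrix.vecMul_transpose,
      dotProduct_comm]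

theorem isCompact_decaySet (A Q : Matrix (Fin n) (Fin n) ℝ) : IsCompact (decaySet A Q) :=
  (isCompact_numericalRange A).add (isCompact_Icc.image Complex.continuous_ofReal)

theorem convex_decaySet (A Q : Matrix (Fin n) (Fin n) ℝ) : Convex ℝ (decaySet A Q) :=
  (convex_numericalRange A).add ((convex_Icc _ _).linear_image Complex.ofRealCLM.toLinearMap)

theorem ofReal_dotProduct_mulVec_mem_numericalRange (A : Matrix (Fin n) (Fin n) ℝ)
    {v : EuclideanSpace ℝ (Fin n)} (hv : ‖v‖ = 1) :
    ((v.ofLp ⬝ᵥ A.mulVec v.ofLp : ℝ) : ℂ) ∈ numericalRange A := by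
  refine ⟨WithLp.toLp 2 fun i => (v i : ℂ), ?_, ?_⟩
  · rw [← hv, EuclideanSpace.norm_eq, EuclideanSpace.norm_eq]
    simp
  · simp [dotProduct, Matrix.mulVec]

theorem numericalRangeTau_pos [NeZero n] {A : Matrix (Fin n) (Fin n) ℝ}
    (hA : numericalRange A ⊆ {z : ℂ | z.re < 0}) : 0 < numericalRangeTau A := by
  rw [numericalRangeTau, abs_pos]
  obtain ⟨v, hv⟩ := exists_norm_eq (EuclideanSpace ℝ (Fin n)) zero_le_one
  have hmem := ofReal_dotProduct_mulVec_mem_numericalRange A hv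
  have hneg := hA hmem
  obtain ⟨R, hR⟩ := (isCompact_numericalRange A).isBounded.exists_norm_le
  have hbdd : BddBelow {x : ℝ | (x : ℂ) ∈ numericalRange A} := by
    refine ⟨-R, fun x hx => ?_⟩
    have := hR _ hx
    rw [Complex.norm_real] at this
    exact (abs_le.1 this).1
  have hle := csInf_le hbdd hmem
  exact (hle.trans_lt hneg).ne

/-- Because `τ > 0`, the set contains a nondegenerate segment. Infinitude rules out degenerate
Zolotarev quotients, since a polynomial vanishing on `E` must be 0. -/
theorem infinite_decaySet [NeZero n] {A Q : Matrix (Fin n) (Fin n) ℝ}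
    (hA : numericalRange A ⊆ {z : ℂ | z.re < 0}) : (decaySet A Q).Infinite := by
  obtain ⟨v, hv⟩ := exists_norm_eq (EuclideanSpace ℝ (Fin n)) zero_le_one
  have hmem := ofReal_dotProduct_mulVec_mem_numericalRange A hv
  have hτ := numericalRangeTau_pos hA
  refine Set.Infinite.mono (s := (fun t : ℝ => ((v.ofLp ⬝ᵥ A.mulVec v.ofLp : ℝ) : ℂ) + t) ''
    Set.Icc (-numericalRangeTau A - Real.sqrt (numericalRangeTau A ^ 2 + ‖Q‖)) 0) ?_ ?_
  · rintro _ ⟨t, ht, rfl⟩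
    exact Set.add_mem_add hmem ⟨t, ht, rfl⟩
  · refine Set.Infinite.image (fun a _ b _ hab => by simpa using hab) (Set.Icc_infinite ?_)
    have := Real.sqrt_nonneg (numericalRangeTau A ^ 2 + ‖Q‖)
    linarith

end numericalRange

section submatrix

variable {𝕜 : Type*} [RCLike 𝕜] {ι κ m n : Type*} [Fintype ι] [Fintype κ] [Fintype m] [Fintype n]

/-- Extension of a vector by zero along `e`. -/
def EuclideanSpace.extendZero (e : ι → n) (x : EuclideanSpace 𝕜 ι) : EuclideanSpace 𝕜 n :=
  WithLp.toLp 2 (Function.extend e x.ofLp 0)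

theorem EuclideanSpace.sum_extendZero {β : Type*} [AddCommMonoid β] {e : ι → n}
    (he : Function.Injective e) (x : EuclideanSpace 𝕜 ι) (f : n → 𝕜 → β) (hf : ∀ i, f i 0 = 0) :
    ∑ i, f i (extendZero e x i) = ∑ i, f (e i) (x i) := by
  symm
  apply Fintype.sum_of_injective e he
  · intro i hi
    simp [extendZero, Function.extend_apply' _ _ _ (fun ⟨a, ha⟩ => hi ⟨a, ha⟩), hf]
  · intro i
    simp [extendZero, he.extend_apply]

theorem EuclideanSpace.norm_extendZero {e : ι → n} (he : Function.Injective e)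
    (x : EuclideanSpace 𝕜 ι) : ‖extendZero e x‖ = ‖x‖ := by
  rw [EuclideanSpace.norm_eq, EuclideanSpace.norm_eq,
    sum_extendZero he x (fun _ a => ‖a‖ ^ 2) (by simp)]

open EuclideanSpace

theorem Matrix.mulVec_extendZero {e₂ : κ → n} (he₂ : Function.Injective e₂) (e₁ : ι → m)
    (M : Matrix m n 𝕜) (x : EuclideanSpace 𝕜 κ) (i : ι) :
    M.mulVec (extendZero e₂ x).ofLp (e₁ i) = (M.submatrix e₁ e₂).mulVec x.ofLp i := by
  simp only [Matrix.mulVec, dotProduct, Matrix.submatrix_apply]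
  exact sum_extendZero he₂ x (fun j a => M (e₁ i) j * a) (by simp)

theorem Matrix.inner_toEuclideanCLM_submatrix [DecidableEq ι] [DecidableEq n] {e : ι → n}
    (he : Function.Injective e) (M : Matrix n n 𝕜) (x : EuclideanSpace 𝕜 ι) :
    ⟪x, Matrix.toEuclideanCLM (𝕜 := 𝕜) (M.submatrix e e) x⟫_𝕜 =
      ⟪extendZero e x, Matrix.toEuclideanCLM (𝕜 := 𝕜) M (extendZero e x)⟫_𝕜 := by
  simp only [EuclideanSpace.inner_eq_star_dotProduct, Matrix.ofLp_toEuclideanCLM, dotProduct,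
    Pi.star_apply]
  rw [sum_extendZero he x
    (fun i a => M.mulVec (extendZero e x).ofLp i * star a) (by simp)]
  simp only [M.mulVec_extendZero he e]

theorem Matrix.l2_opNorm_submatrix_le [DecidableEq κ] [DecidableEq n] {e₁ : ι → m} {e₂ : κ → n}
    (he₁ : Function.Injective e₁) (he₂ : Function.Injective e₂) (M : Matrix m n 𝕜) :
    ‖M.submatrix e₁ e₂‖ ≤ ‖M‖ := by
  rw [Matrix.l2_opNorm_def]
  refine ContinuousLinearMap.opNorm_le_bound _ (norm_nonneg _) fun x => ?_
  refine le_trans ?_ ((M.norm_toEuclideanLin_le (extendZero e₂ x)).trans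
    (by rw [norm_extendZero he₂]))
  apply le_of_sq_le_sq _ (norm_nonneg _)
  rw [EuclideanSpace.norm_sq_eq, EuclideanSpace.norm_sq_eq]
  have h1 : ∀ i, (Matrix.toEuclideanLin (M.submatrix e₁ e₂) x) i =
      (Matrix.toEuclideanLin M (extendZero e₂ x)) (e₁ i) := fun i =>
    (M.mulVec_extendZero he₂ e₁ x i).symm
  calc _ = ∑ i, ‖(Matrix.toEuclideanLin M (extendZero e₂ x)) (e₁ i)‖ ^ 2 :=
        Finset.sum_congr rfl fun i _ => by rw [← h1]; rfl
    _ = ∑ i ∈ Finset.univ.map ⟨e₁, he₁⟩, ‖(Matrix.toEuclideanLin M (extendZero e₂ x)) i‖ ^ 2 := by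
        rw [Finset.sum_map]; rfl
    _ ≤ _ := Finset.sum_le_sum_of_subset_of_nonneg (Finset.subset_univ _)
        fun _ _ _ => by positivity

open scoped MatrixOrder in
theorem Matrix.PosSemidef.exists_eq_star_mul_self [DecidableEq n] {X : Matrix n n ℝ}
    (hX : X.PosSemidef) : ∃ B : Matrix n n ℝ, X = star B * B :=
  CStarAlgebra.nonneg_iff_eq_star_mul_self.1 hX.nonneg

theorem Matrix.inner_toEuclideanCLM_map_of_posSemidef [DecidableEq n] {X : Matrix n n ℝ}
    (hX : X.PosSemidef) (x : EuclideanSpace ℂ n) :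
    ∃ r : ℝ, ⟪x, Matrix.toEuclideanCLM (𝕜 := ℂ) (X.map Complex.ofReal) x⟫_ℂ = r ∧ 0 ≤ r ∧
      r ≤ ‖X‖ * ‖x‖ ^ 2 := by
  obtain ⟨B, hB⟩ := hX.exists_eq_star_mul_self
  have hmap : X.map Complex.ofReal = star (B.map Complex.ofReal) * B.map Complex.ofReal := by
    rw [hB]
    ext i j
    simp [Matrix.mul_apply]
  have h1 : ⟪x, Matrix.toEuclideanCLM (𝕜 := ℂ) (X.map Complex.ofReal) x⟫_ℂ =
      ((‖Matrix.toEuclideanCLM (𝕜 := ℂ) (B.map Complex.ofReal) x‖ ^ 2 : ℝ) : ℂ) := by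
    rw [hmap, map_mul, map_star, mul_apply_eq_comp,
      ContinuousLinearMap.star_eq_adjoint, ContinuousLinearMap.adjoint_inner_right,
      inner_self_eq_norm_sq_to_K]
    simp
  refine ⟨_, h1, by positivity, ?_⟩
  have h2 := norm_inner_le_norm (𝕜 := ℂ) x
    (Matrix.toEuclideanCLM (𝕜 := ℂ) (X.map Complex.ofReal) x)
  rw [h1, Complex.norm_real, Real.norm_of_nonneg (by positivity)] at h2
  have h3 : ‖Matrix.toEuclideanCLM (𝕜 := ℂ) (X.map Complex.ofReal) x‖ ≤ ‖X‖ * ‖x‖ :=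
    X.norm_toEuclideanLin_map_le x
  nlinarith [norm_nonneg x]

theorem Matrix.norm_le_of_eigenvalues_le [DecidableEq n] {X : Matrix n n ℝ} (hX : X.PosSemidef)
    {c : ℝ} (hc : 0 ≤ c) (h : ∀ i, hX.isHermitian.eigenvalues i ≤ c) : ‖X‖ ≤ c := by
  rw [Matrix.l2_opNorm_def]
  refine ContinuousLinearMap.opNorm_le_bound _ hc fun x => ?_
  set b := hX.isHermitian.eigenvectorBasis
  apply le_of_sq_le_sq _ (by positivity)
  rw [mul_pow, ← b.sum_sq_norm_inner_right, ← b.sum_sq_norm_inner_right, Finset.mul_sum]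
  refine Finset.sum_le_sum fun i _ => ?_
  have hsymm : (Matrix.toEuclideanLin X).IsSymmetric :=
    Matrix.isSymmetric_toEuclideanLin_iff.2 hX.isHermitian
  have h1 : ⟪b i, Matrix.toEuclideanLin X x⟫_ℝ = hX.isHermitian.eigenvalues i * ⟪b i, x⟫_ℝ := by
    rw [← hsymm (b i) x]
    have : Matrix.toEuclideanLin X (b i) = hX.isHermitian.eigenvalues i • b i := by
      ext j
      exact congrFun (hX.isHermitian.mulVec_eigenvectorBasis i) j
    rw [this, inner_smul_left]
    rfl
  have h2 := hX.eigenvalues_nonneg i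
  show ‖⟪b i, Matrix.toEuclideanLin X x⟫_ℝ‖ ^ 2 ≤ _
  rw [h1, norm_mul, mul_pow, Real.norm_of_nonneg h2]
  gcongr
  exact h i

end submatrix

/-- At a unit eigenvector `v` of `X` with eigenvalue `l` the equation reads `2 l vᵀAv - l² + vᵀQv =
0`. Since `vᵀAv < 0 ≤ l`, this gives `l² ≤ vᵀQv ≤ ‖Q‖`. -/
theorem SolvesRiccati.norm_le {n : ℕ} {A Q X : Matrix (Fin n) (Fin n) ℝ}
    (hA : numericalRange A ⊆ {z : ℂ | z.re < 0}) (hX : X.PosSemidef)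
    (hcare : SolvesRiccati A 1 Q X) : ‖X‖ ≤ Real.sqrt ‖Q‖ := by
  refine Matrix.norm_le_of_eigenvalues_le hX (Real.sqrt_nonneg _) fun i => ?_
  apply Real.le_sqrt_of_sq_le
  set l := hX.isHermitian.eigenvalues i
  have hl : 0 ≤ l := hX.eigenvalues_nonneg i
  set v := hX.isHermitian.eigenvectorBasis i
  have hv : ‖v‖ = 1 := hX.isHermitian.eigenvectorBasis.norm_eq_one i
  have hXv : X.mulVec v.ofLp = l • v.ofLp := hX.isHermitian.mulVec_eigenvectorBasis i
  have hvX : Matrix.vecMul v.ofLp X = l • v.ofLp := by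
    rw [← hXv, ← Matrix.vecMul_transpose]
    congr 1
    exact hX.isHermitian.symm
  have hvv : v.ofLp ⬝ᵥ v.ofLp = 1 := by
    have := real_inner_self_eq_norm_sq v
    rw [hv, EuclideanSpace.inner_eq_star_dotProduct] at this
    simpa using this
  have hneg : v.ofLp ⬝ᵥ A.mulVec v.ofLp < 0 :=
    hA (ofReal_dotProduct_mulVec_mem_numericalRange A hv)
  have hQ : v.ofLp ⬝ᵥ Q.mulVec v.ofLp ≤ ‖Q‖ := by
    have h1 := real_inner_le_norm v (Matrix.toEuclideanLin Q v)
    have h2 := Q.norm_toEuclideanLin_le v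
    rw [hv, mul_one] at h2
    rw [hv, one_mul, EuclideanSpace.inner_eq_star_dotProduct, dotProduct_comm] at h1
    exact h1.trans h2
  have hat : v.ofLp ⬝ᵥ A.transpose.mulVec v.ofLp = v.ofLp ⬝ᵥ A.mulVec v.ofLp := by
    rw [Matrix.dotProduct_mulVec, Matrix.vecMul_transpose, dotProduct_comm]
  have h0 := congrArg (fun M : Matrix (Fin n) (Fin n) ℝ => v.ofLp ⬝ᵥ M.mulVec v.ofLp) hcare
  simp only [Matrix.add_mulVec, Matrix.sub_mulVec, ← Matrix.mulVec_mulVec, Matrix.mul_one,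
    Matrix.zero_mulVec, dotProduct_add, dotProduct_sub, dotProduct_zero, hXv, Matrix.mulVec_smul,
    dotProduct_smul, hat] at h0
  rw [Matrix.dotProduct_mulVec v.ofLp X, hvX, smul_dotProduct, hvv] at h0
  simp only [smul_eq_mul] at h0
  nlinarith

end

/-! ### Zolotarev numbers and the decay estimate for offdiagonal blocks. -/

noncomputable section

open scoped InnerProductSpace
open Polynomial

theorem singularValue_le_norm {ι κ : Type*} [Fintype ι] [Fintype κ] [DecidableEq κ]
    (M : Matrix ι κ ℝ) (r : ℕ) : singularValue M (r + 1) ≤ ‖M‖ :=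
  singularValue_le_of_ker (V := PUnit) M (norm_nonneg _) 0
    (Module.finrank_zero_of_subsingleton.trans_le r.zero_le)
    fun w _ => M.norm_toEuclideanLin_map_le w

theorem singularValue_antitone {ι κ : Type*} [Fintype ι] [Fintype κ] [DecidableEq κ]
    (M : Matrix ι κ ℝ) : Antitone (singularValue M) := fun _ _ h =>
  (Matrix.toEuclideanLin M).singularValues_antitone (Nat.sub_le_sub_right h 1)

section zolotarev

variable {h : ℕ} {E G : Set ℂ}

theorem zolotarevNumber_ne_top (h : ℕ) (E G : Set ℂ) : zolotarevNumber h E G ≠ ⊤ := by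
  have hmem : (1 : RatFunc ℂ) ∈ zolotarevAdmissible h E G := by
    simp [zolotarevAdmissible]
  have hone : ∀ z, ratFuncModulus 1 z = 1 := fun z => by simp [ratFuncModulus]
  refine ne_top_of_le_ne_top ENNReal.one_ne_top ((iInf₂_le 1 hmem).trans ?_)
  simp only [hone]
  refine ENNReal.div_le_of_le_mul ?_
  rw [one_mul]
  exact (iSup₂_le fun _ _ => le_rfl).trans (le_iInf₂ fun _ _ => le_rfl)

/-- An admissible rational function whose Zolotarev quotient is finite yields real bounds for its
numerator and denominator. -/
theorem exists_bounds_of_mem_zolotarevAdmissible (hE : E.Infinite) (hG : G.Infinite)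
    {g : RatFunc ℂ} (hg : g ∈ zolotarevAdmissible h E G)
    (hfin : (⨆ z ∈ E, ratFuncModulus g z) / (⨅ z ∈ G, ratFuncModulus g z) ≠ ⊤) :
    ∃ S m : ℝ, 0 ≤ S ∧ 0 < m ∧
      S / m = ((⨆ z ∈ E, ratFuncModulus g z) / (⨅ z ∈ G, ratFuncModulus g z)).toReal ∧
      (∀ z ∈ E, ‖g.num.eval z‖ ≤ S * ‖g.denom.eval z‖) ∧
      ∀ z ∈ G, m * ‖g.denom.eval z‖ ≤ ‖g.num.eval z‖ := by
  obtain ⟨-, -, hden, hnum⟩ := hg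
  set s := ⨆ z ∈ E, ratFuncModulus g z with hs
  set m := ⨅ z ∈ G, ratFuncModulus g z with hm
  have hm_top : m ≠ ⊤ := by
    obtain ⟨z, hzG, hz⟩ := hG.exists_notMem_finset g.denom.roots.toFinset
    have hz0 : g.denom.eval z ≠ 0 := by
      simpa [g.denom_ne_zero] using hz
    refine ne_top_of_le_ne_top ?_ (iInf₂_le z hzG)
    exact ENNReal.div_ne_top enorm_ne_top (by simpa using hz0)
  have hs_top : s ≠ ⊤ := by
    intro htop
    rw [htop, ENNReal.top_div_of_ne_top hm_top] at hfin
    exact hfin rfl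
  have hs_le : ∀ z ∈ E, ‖g.num.eval z‖ₑ ≤ s * ‖g.denom.eval z‖ₑ := by
    intro z hz
    have h1 : ratFuncModulus g z ≤ s := le_iSup₂ (f := fun z _ => ratFuncModulus g z) z hz
    exact (ENNReal.div_le_iff (by simpa using hden z hz) enorm_ne_top).1 h1
  have hm_le : ∀ z ∈ G, m * ‖g.denom.eval z‖ₑ ≤ ‖g.num.eval z‖ₑ := by
    intro z hz
    have h1 : m ≤ ratFuncModulus g z := iInf₂_le z hz
    exact ENNReal.mul_le_of_le_div h1
  -- If the infimum were 0, finiteness of the quotient would force the supremum to be 0 as well. The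
  -- numerator would then vanish on the infinite set `E`, hence identically, contradicting that it
  -- has no zeros on `G`.
  have hm0 : m ≠ 0 := by
    intro h0
    have hs0 : s = 0 := by
      by_contra hs0
      rw [h0, ENNReal.div_zero hs0] at hfin
      exact hfin rfl
    have hz : ∀ z ∈ E, g.num.eval z = 0 := by
      intro z hz
      have := hs_le z hz
      rw [hs0, zero_mul] at this
      simpa using this
    have hn0 : g.num = 0 := Polynomial.eq_zero_of_infinite_isRoot _ (hE.mono hz)
    obtain ⟨z, hzG⟩ := hG.nonempty
    exact hnum z hzG (by rw [hn0, eval_zero])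
  refine ⟨s.toReal, m.toReal, ENNReal.toReal_nonneg, ENNReal.toReal_pos hm0 hm_top,
    (ENNReal.toReal_div s m).symm, fun z hz => ?_, fun z hz => ?_⟩
  · have := ENNReal.toReal_mono (ENNReal.mul_ne_top hs_top enorm_ne_top) (hs_le z hz)
    simpa using this
  · have := ENNReal.toReal_mono enorm_ne_top (hm_le z hz)
    simpa using this

/-- The infimum need not be attained, so a near-optimal function is used; the tolerance `ε / (c +
1)` also covers `c = 0`. -/
theorem le_mul_toReal_zolotarevNumber (hE : E.Infinite) (hG : G.Infinite) {x c : ℝ} (hc : 0 ≤ c)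
    (hx : ∀ p q : ℂ[X], p.natDegree ≤ h → q.natDegree ≤ h → (∀ z ∈ E, q.eval z ≠ 0) →
      (∀ z ∈ G, p.eval z ≠ 0) → ∀ S m : ℝ, 0 ≤ S → 0 < m →
      (∀ z ∈ E, ‖p.eval z‖ ≤ S * ‖q.eval z‖) → (∀ z ∈ G, m * ‖q.eval z‖ ≤ ‖p.eval z‖) →
      x ≤ c * (S / m)) :
    x ≤ c * (zolotarevNumber h E G).toReal := by
  have htop := zolotarevNumber_ne_top h E G
  apply le_of_forall_pos_le_add
  intro ε hε
  have hlt : zolotarevNumber h E G < zolotarevNumber h E G + ENNReal.ofReal (ε / (c + 1)) :=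
    ENNReal.lt_add_right htop (by simpa using by positivity)
  nth_rw 1 [zolotarevNumber] at hlt
  simp only [iInf_lt_iff] at hlt
  obtain ⟨g, hg, hlt⟩ := hlt
  obtain ⟨S, m, hS, hm, hSm, h1, h2⟩ :=
    exists_bounds_of_mem_zolotarevAdmissible hE hG hg hlt.ne_top
  have h3 := hx g.num g.denom hg.1 hg.2.1 hg.2.2.1 hg.2.2.2 S m hS hm h1 h2
  have h4 : S / m ≤ (zolotarevNumber h E G).toReal + ε / (c + 1) := by
    have := ENNReal.toReal_mono (ENNReal.add_ne_top.2 ⟨htop, ENNReal.ofReal_ne_top⟩) hlt.le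
    rwa [← hSm, ENNReal.toReal_add htop ENNReal.ofReal_ne_top,
      ENNReal.toReal_ofReal (by positivity)] at this
  calc x ≤ c * (S / m) := h3
    _ ≤ c * ((zolotarevNumber h E G).toReal + ε / (c + 1)) := by gcongr
    _ = c * (zolotarevNumber h E G).toReal + c * (ε / (c + 1)) := by ring
    _ ≤ _ := by
      gcongr
      rw [mul_div_assoc', div_le_iff₀ (by positivity)]
      nlinarith

end zolotarev

section riccati

variable {n : ℕ} {A Q X : Matrix (Fin n) (Fin n) ℝ}

/-- Extension by zero turns the compression into a value of `B - X` at a unit vector, where `X`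
contributes a real number in `[0, ‖X‖]` and `‖X‖ ≤ √‖Q‖ ≤ τ + √(τ² + ‖Q‖)`. It is needed for `B =
Aᵀ` and `B = A`. -/
theorem inner_sub_mem_decaySet (hA : numericalRange A ⊆ {z : ℂ | z.re < 0}) (hX : X.PosSemidef)
    (hcare : SolvesRiccati A 1 Q X) {B : Matrix (Fin n) (Fin n) ℝ}
    (hB : numericalRange B ⊆ numericalRange A) {ι : Type*} [Fintype ι] [DecidableEq ι]
    {e : ι → Fin n} (he : Function.Injective e) {x : EuclideanSpace ℂ ι} (hx : ‖x‖ = 1) :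
    ⟪x, Matrix.toEuclideanCLM (𝕜 := ℂ) (((B - X).submatrix e e).map Complex.ofReal) x⟫_ℂ ∈
      decaySet A Q := by
  set y := EuclideanSpace.extendZero e x with hy
  have hy1 : ‖y‖ = 1 := by rw [hy, EuclideanSpace.norm_extendZero he, hx]
  obtain ⟨r, hr, hr0, hrX⟩ := Matrix.inner_toEuclideanCLM_map_of_posSemidef hX y
  have hmap : (B - X).map Complex.ofReal = B.map Complex.ofReal - X.map Complex.ofReal :=
    Matrix.map_sub _ Complex.ofReal_sub B X
  rw [← Matrix.submatrix_map, Matrix.inner_toEuclideanCLM_submatrix he, ← hy, hmap, map_sub,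
    sub_apply, inner_sub_right, hr, sub_eq_add_neg]
  refine Set.add_mem_add (hB ?_) ⟨-r, ⟨?_, by linarith⟩, by simp⟩
  · rw [numericalRange_eq]
    exact ⟨y, hy1, rfl⟩
  · have h1 := hcare.norm_le hA hX
    have h2 : Real.sqrt ‖Q‖ ≤ Real.sqrt (numericalRangeTau A ^ 2 + ‖Q‖) :=
      Real.sqrt_le_sqrt (by nlinarith [sq_nonneg (numericalRangeTau A)])
    have h3 : 0 ≤ numericalRangeTau A := abs_nonneg _
    rw [hy1] at hrX
    linarith

/-- Decay of the singular values of an offdiagonal block of the solution of a Riccati equation. -/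
theorem singularValue_submatrix_le (hA : numericalRange A ⊆ {z : ℂ | z.re < 0})
    (hX : X.PosSemidef) (hcare : SolvesRiccati A 1 Q X) {P R : Fin n → Prop} [DecidablePred P]
    [DecidablePred R] (hPR : ∀ i, R i ↔ ¬ P i) [Nonempty {i // P i}] [Nonempty {i // R i}]
    {ra rq : ℕ}
    (h1 : (A.submatrix (Subtype.val : {i // P i} → Fin n)
      (Subtype.val : {i // R i} → Fin n)).rank ≤ ra)
    (h2 : (A.submatrix (Subtype.val : {i // R i} → Fin n)
      (Subtype.val : {i // P i} → Fin n)).rank ≤ ra)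
    (h3 : (Q.submatrix (Subtype.val : {i // P i} → Fin n)
      (Subtype.val : {i // R i} → Fin n)).rank ≤ rq) (h : ℕ) :
    singularValue (X.submatrix (Subtype.val : {i // P i} → Fin n)
      (Subtype.val : {i // R i} → Fin n)) (h * (4 * ra + 2 * rq) + 1) ≤
      (1 + Real.sqrt 2) ^ 2 *
        (zolotarevNumber h (decaySet A Q) (-decaySet A Q)).toReal * ‖X‖ := by
  have hn : NeZero n := ⟨by
    rintro rfl
    obtain ⟨i, -⟩ := ‹Nonempty {i : Fin 0 // P i}›
    exact i.elim0⟩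
  set vP : {i // P i} → Fin n := Subtype.val with hvP
  set vR : {i // R i} → Fin n := Subtype.val with hvR
  have hP : Function.Injective vP := Subtype.val_injective
  have hR : Function.Injective vR := Subtype.val_injective
  set M := X.submatrix vP vR with hM
  have hblock : ∀ (Y Z : Matrix (Fin n) (Fin n) ℝ), (Y * Z).submatrix vP vR =
      Y.submatrix vP vP * Z.submatrix vP vR + Y.submatrix vP vR * Z.submatrix vR vR := by
    intro Y Z
    ext i j
    simp only [Matrix.submatrix_apply, Matrix.mul_apply, Matrix.add_apply]
    rw [← Fintype.sum_subtype_add_sum_subtype P fun k => Y (vP i) k * Z k (vR j)]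
    congr 1
    exact Fintype.sum_equiv (Equiv.subtypeEquivRight fun k => (hPR k).symm) _ _ fun _ => rfl
  obtain ⟨F₁, G₁, hFG₁⟩ := (A.transpose.submatrix vP vR).exists_mul_eq_of_rank
  obtain ⟨F₂, G₂, hFG₂⟩ := (A.submatrix vP vR).exists_mul_eq_of_rank
  obtain ⟨F₃, G₃, hFG₃⟩ := (Q.submatrix vP vR).exists_mul_eq_of_rank
  set L := (A.transpose - X).submatrix vP vP with hL
  set N := -(A - X).submatrix vR vR with hN
  -- The `(P, R)` block of `X²` is `X_PP M + M X_RR`, which goes into `L` and `N`. There remains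
  -- `-(Aᵀ)_PR X_RR - X_PP A_PR - Q_PR`, of rank at most `2 ra + rq`.
  have hsyl : L * M - M * N = Matrix.fromCols (-F₁) (Matrix.fromCols (-(X.submatrix vP vP * F₂))
      (-F₃)) * Matrix.fromRows (G₁ * X.submatrix vR vR) (Matrix.fromRows G₂ G₃) := by
    have hc := congrArg (fun B : Matrix (Fin n) (Fin n) ℝ => B.submatrix vP vR) hcare
    simp only [Matrix.mul_one, Matrix.submatrix_add, Matrix.submatrix_sub, Pi.add_apply,
      Pi.sub_apply, hblock, Matrix.submatrix_zero, Pi.zero_apply] at hc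
    rw [Matrix.fromCols_mul_fromRows, Matrix.fromCols_mul_fromRows]
    simp only [Matrix.neg_mul, Matrix.mul_assoc]
    rw [← Matrix.mul_assoc F₁, ← hFG₁, ← hFG₂, ← hFG₃, hL, hN, hM]
    simp only [Matrix.submatrix_sub, Pi.sub_apply, Matrix.sub_mul, Matrix.mul_sub,
      Matrix.mul_neg]
    rw [← sub_eq_zero, ← hc]
    abel
  have hE := isCompact_decaySet A Q
  have hEc := convex_decaySet A Q
  have hEinf := infinite_decaySet (Q := Q) hA
  have hLE : ∀ x, ‖x‖ = 1 →
      ⟪x, Matrix.toEuclideanCLM (𝕜 := ℂ) (L.map Complex.ofReal) x⟫_ℂ ∈ decaySet A Q :=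
    fun x hx => inner_sub_mem_decaySet hA hX hcare (numericalRange_transpose A) hP hx
  have hNE : ∀ x, ‖x‖ = 1 →
      ⟪x, Matrix.toEuclideanCLM (𝕜 := ℂ) (N.map Complex.ofReal) x⟫_ℂ ∈ -decaySet A Q := by
    intro x hx
    have := inner_sub_mem_decaySet hA hX hcare (subset_refl (numericalRange A)) hR hx
    rw [Set.mem_neg, hN, show (-(A - X).submatrix vR vR).map Complex.ofReal =
      -((A - X).submatrix vR vR).map Complex.ofReal by ext; simp, map_neg, neg_apply,
      inner_neg_right, neg_neg]
    exact this
  have hMX : ‖M‖ ≤ ‖X‖ := X.l2_opNorm_submatrix_le hP hR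
  have hrank : 2 * h * Fintype.card (Fin (A.transpose.submatrix vP vR).rank ⊕
      (Fin (A.submatrix vP vR).rank ⊕ Fin (Q.submatrix vP vR).rank)) ≤
      h * (4 * ra + 2 * rq) := by
    have h2' : (A.transpose.submatrix vP vR).rank ≤ ra := by
      rw [← Matrix.transpose_submatrix, Matrix.rank_transpose]; exact h2
    simp only [Fintype.card_sum, Fintype.card_fin]
    rw [mul_comm 2 h, mul_assoc]
    exact Nat.mul_le_mul_left h (by omega)
  rw [mul_right_comm]
  refine le_mul_toReal_zolotarevNumber hEinf ((Set.infinite_neg).2 hEinf) (by positivity) ?_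
  intro p q hp hq hq0 hp0 S m hS hm hpq hqp
  -- Squaring the rational function doubles the degree to `2 h`; since `t` is twice the rank bound,
  -- the index is still at most `h t + 1`.
  have key := singularValue_le_of_sylvester L N M _ _ hsyl hE hEc hE.neg hEc.neg hLE hNE
    (p := p ^ 2) (q := q ^ 2) (d := 2 * h) (a := S ^ 2) (b := (1 / m) ^ 2)
    (natDegree_pow_le.trans (by gcongr)) (natDegree_pow_le.trans (by gcongr))
    (fun z hz => by rw [eval_pow]; exact pow_ne_zero _ (hq0 z hz))
    (fun z hz => by rw [eval_pow]; exact pow_ne_zero _ (hp0 z hz))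
    (by positivity) (by positivity)
    (fun z hz => by
      rw [eval_pow, eval_pow, norm_pow, norm_pow, ← mul_pow]
      gcongr
      exact hpq z hz)
    (fun z hz => by
      rw [eval_pow, eval_pow, norm_pow, norm_pow, ← mul_pow]
      gcongr
      rw [one_div, ← div_eq_inv_mul, le_div_iff₀ hm, mul_comm]
      exact hqp z hz)
  have hσ1 := (singularValue_antitone M (Nat.add_le_add_right hrank 1)).trans key
  have hσ2 := singularValue_le_norm M (h * (4 * ra + 2 * rq))
  set σ := singularValue M (h * (4 * ra + 2 * rq) + 1)
  set u := S / m with hu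
  have hu0 : 0 ≤ u := by positivity
  have hM0 := norm_nonneg M
  have hσ3 : σ ≤ 9 * u ^ 2 * ‖M‖ := by
    refine hσ1.trans_eq ?_
    rw [hu]
    ring
  have hσ4 : σ ≤ 3 * u * ‖M‖ := by
    -- With `y = 3 u`, the bounds `y²` and `1` together give `min (y², 1) ≤ y`, so one factor 3 is
    -- saved.
    rcases le_total (3 * u) 1 with h' | h'
    · refine hσ3.trans (mul_le_mul_of_nonneg_right ?_ hM0)
      nlinarith
    · exact hσ2.trans (le_mul_of_one_le_left hM0 h')
  have hconst : (3 : ℝ) ≤ (1 + Real.sqrt 2) ^ 2 := by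
    nlinarith [Real.sq_sqrt (show (0 : ℝ) ≤ 2 by norm_num), Real.sqrt_nonneg 2]
  calc σ ≤ 3 * u * ‖M‖ := hσ4
    _ ≤ (1 + Real.sqrt 2) ^ 2 * u * ‖X‖ := by gcongr
    _ = _ := by ring

end riccati

end

theorem corollary2p4 (n : ℕ) (A Q X : Matrix (Fin n) (Fin n) ℝ) (ra rq : ℕ)
    (hra : qsrank A = ra) (hrq : qsrank Q = rq)
    (hA : numericalRange A ⊆ {z : ℂ | z.re < 0})
    (hQ : Q.PosSemidef) (hX : X.PosSemidef) (hcare : SolvesRiccati A 1 Q X)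
    (h : ℕ) (hh : 1 ≤ h) (s : ℕ) (hs : 1 ≤ s) (hsn : s < n) :
    singularValue (lowerOffBlock X s) (h * (4 * ra + 2 * rq) + 1) ≤
        (1 + Real.sqrt 2) ^ 2 *
          (zolotarevNumber h (decaySet A Q) (-decaySet A Q)).toReal * ‖X‖ ∧
      singularValue (upperOffBlock X s) (h * (4 * ra + 2 * rq) + 1) ≤
        (1 + Real.sqrt 2) ^ 2 *
          (zolotarevNumber h (decaySet A Q) (-decaySet A Q)).toReal * ‖X‖ := by
  have hmem : s ∈ Finset.Ico 1 n := Finset.mem_Ico.2 ⟨hs, hsn⟩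
  have hle : ∀ B : Matrix (Fin n) (Fin n) ℝ,
      max (lowerOffBlock B s).rank (upperOffBlock B s).rank ≤ qsrank B := fun B =>
    Finset.le_sup (f := fun s => max (lowerOffBlock B s).rank (upperOffBlock B s).rank) hmem
  have hAl := (le_max_left _ _).trans ((hle A).trans hra.le)
  have hAu := (le_max_right _ _).trans ((hle A).trans hra.le)
  have hQl := (le_max_left _ _).trans ((hle Q).trans hrq.le)
  have hQu := (le_max_right _ _).trans ((hle Q).trans hrq.le)
  have hne1 : Nonempty {i : Fin n // s ≤ i.val} := ⟨⟨⟨s, hsn⟩, le_rfl⟩⟩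
  have hne2 : Nonempty {i : Fin n // i.val < s} := ⟨⟨⟨0, by omega⟩, hs⟩⟩
  exact ⟨singularValue_submatrix_le hA hX hcare (P := fun i => s ≤ i.val)
      (R := fun i => i.val < s) (fun i => not_le.symm) hAl hAu hQl h,
    singularValue_submatrix_le hA hX hcare (P := fun i => i.val < s)
      (R := fun i => s ≤ i.val) (fun i => not_lt.symm) hAu hAl hQu h⟩
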